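/- There is an absolute constant $C$ such that the following holds for all integers $m\ge 2$ and $n\ge 0$. Let $\mathcal D=\mathcal D_1\times\dots\times\mathcal D_n$, where $\mathcal D_i$ is any probability distribution of the valuation $v_i$ of buyer $i$ over $m$ items, supported on subadditive valuations. Then $$\textsc{EARev}(\mathcal D,\textsc{BuyMany})\;\le\; C\,(\log m)^2\cdot \textsc{Rev}(\mathcal D,\textsc{SeqItemPricing}).$$ (Both sides are elements of $[0,\infty]$.) Here: * A valuation is a monotone function $v:2^{[m]}\to\mathbb R_{\ge 0}$ with $v(\emptyset)=0$; it is subadditive if $v(S\cup T)\le v(S)+v(T)$ for all $S,T\subseteq[m]$. * A lottery is a probability distribution $\lambda$ on $2^{[m]}$, with value $v(\lambda)=\mathbb E_{S\sim\lambda}[v(S)]$. A price menu $p$ assigns a price $p(\lambda)\in[0,\infty]$ to every lottery ($\infty$ means not offered), and the lottery that gives $\emptyset$ with certainty has price $0$. A buyer with valuation $v$ buys an offered lottery that maximizes $v(\lambda)-p(\lambda)$ and that has maximal price among the maximizers. * A (finite) adaptive buying strategy buys lotteries one after another, where whether and what to buy next may depend on the sets drawn so far; it obtains the union of the drawn sets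 and pays the sum of the prices. A menu $p$ is buy-many if for every adaptive buying strategy there is a lottery $\lambda$ whose price is at most the expected total payment of the strategy, and for which there is a coupling of $S\sim\lambda$ with the random set $S'$ obtained by the strategy such that $S'\subseteq S$. * A buy-many mechanism for $\mathcal D_i$ is a buy-many menu together with a measurable choice of a purchase for $\mathcal D_i$-almost every valuation. Its revenue is the expected price paid, and its allocation is the vector in $[0,1]^m$ of the probabilities with which the items are sold. For $x_i\in\mathbb R_{\ge0}^m$, $\textsc{Rev}_{x_i}(\mathcal D_i,\textsc{BuyMany})$ is the supremum, over all probability distributions over buy-many mechanisms whose expected allocation is at most $x_i$ in every coordinate, of the expected revenue, and $$\textsc{EARev}(\mathcal D,\textsc{BuyMany})=\sup\Big\{\sum_{i=1}^n\textsc{Rev}_{x_i}(\mathcal D_i,\textsc{BuyMany})\;:\;x_i\in\mathbb R_{\ge 0}^m,\ \sum_{i=1}^n x_{ij}\le 1\text{ for all }j\in[m]\Big\}.$$ * A sequential item pricing mechanism interacts with the buyers in the given order $1,\dots,n$. When buyer $i$ arrives and $S_i$ is the set of items left over, it posts item prices in $[0,\infty]$ ($\infty$ means not offered), which may depend on internal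 randomness, on $S_i$ and on $v_1,\dots,v_{i-1}$. The buyer buys a set $B\subseteq S_i$ of finite total price that maximizes $v_i(B)$ minus the total price and that has maximal total price among the maximizers; remaining ties are settled by an arbitrary fixed measurable rule for each buyer, and the inequality holds for every such rule. $\textsc{Rev}(\mathcal D,\textsc{SeqItemPricing})$ is the supremum of the expected total payment, for $v\sim\mathcal D$, over all sequential item pricing mechanisms. -/

import Mathlib

open MeasureTheory
open scoped ENNReal NNReal

noncomputable section

namespace BuyMany

/-! ### Valuations -/

/-- A (normalized, monotone) valuation over `m` items: it assigns a nonnegative value to every set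
of items, the empty set has value `0`, and larger sets are worth at least as much.
The `σ`-algebra is the one inherited from `Finset (Fin m) → ℝ≥0`. -/
abbrev Valuation (m : ℕ) : Type :=
  {v : Finset (Fin m) → ℝ≥0 // v ∅ = 0 ∧ Monotone v}

/-- A valuation is subadditive if `v (S ∪ T) ≤ v S + v T` for all sets of items `S`, `T`. -/
def IsSubadditive {m : ℕ} (v : Valuation m) : Prop :=
  ∀ S T : Finset (Fin m), v.1 (S ∪ T) ≤ v.1 S + v.1 T

/-! ### Lotteries and price menus -/

/-- A lottery is a probability distribution over sets of items. -/
abbrev Lottery (m : ℕ) : Type := PMF (Finset (Fin m))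

/-- The expected value of a lottery. -/
def lotteryValue {m : ℕ} (v : Valuation m) (ℓ : Lottery m) : ℝ :=
  ∑ S : Finset (Fin m), (ℓ S).toReal * (v.1 S : ℝ)

/-- The probability that the random set drawn from the lottery `ℓ` contains item `j`. -/
def itemProb {m : ℕ} (ℓ : Lottery m) (j : Fin m) : ℝ≥0∞ :=
  ∑ S : Finset (Fin m) with j ∈ S, ℓ S

/-- `Dominates ℓ ℓ'`: there is a coupling of `S ∼ ℓ` and `S' ∼ ℓ'` in which `S' ⊆ S`. -/
def Dominates {m : ℕ} (ℓ ℓ' : Lottery m) : Prop :=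
  ∃ κ : PMF (Finset (Fin m) × Finset (Fin m)),
    κ.map Prod.fst = ℓ ∧ κ.map Prod.snd = ℓ' ∧ ∀ x ∈ κ.support, x.2 ⊆ x.1

/-- A price menu gives every lottery a price; price `∞` means that the lottery is not offered.
Getting nothing costs nothing. -/
structure PriceMenu (m : ℕ) where
  price : Lottery m → ℝ≥0∞
  price_empty : price (PMF.pure ∅) = 0

/-- The utility of a buyer with valuation `v` who buys the (offered) lottery `ℓ`. -/
def PriceMenu.utility {m : ℕ} (p : PriceMenu m) (v : Valuation m) (ℓ : Lottery m) : ℝ :=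
  lotteryValue v ℓ - (p.price ℓ).toReal

/-- `ℓ` is a possible purchase of a buyer with valuation `v` facing the menu `p`: it is offered, it
maximizes the utility of the buyer, and it has maximal price among the utility maximizers. -/
def PriceMenu.IsPurchase {m : ℕ} (p : PriceMenu m) (v : Valuation m) (ℓ : Lottery m) : Prop :=
  p.price ℓ ≠ ∞ ∧
  (∀ ℓ', p.price ℓ' ≠ ∞ → p.utility v ℓ' ≤ p.utility v ℓ) ∧
  (∀ ℓ', p.price ℓ' ≠ ∞ → p.utility v ℓ' = p.utility v ℓ → p.price ℓ' ≤ p.price ℓ)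

/-! ### Buy-many menus -/

/-- An adaptive buying strategy: either finish, or buy a lottery, observe the set that was drawn from
it, and continue with a strategy that may depend on that set. -/
inductive Strategy (m : ℕ) : Type
  | done : Strategy m
  | buy (ℓ : Lottery m) (next : Finset (Fin m) → Strategy m) : Strategy m

/-- The distribution of the union of all sets obtained by a strategy. -/
def Strategy.outcome {m : ℕ} : Strategy m → Lottery m
  | .done => PMF.pure ∅
  | .buy ℓ next => ℓ.bind fun S => ((next S).outcome).map fun T => S ∪ T

/-- The expected total price paid by a strategy under the price menu `p`. -/
def Strategy.cost {m : ℕ} (p : PriceMenu m) : Strategy m → ℝ≥0∞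
  | .done => 0
  | .buy ℓ next => p.price ℓ + ∑ S : Finset (Fin m), ℓ S * (next S).cost p

/-- The class of buy-many menus: for every adaptive strategy there is a single lottery which
dominates the random set obtained by the strategy and costs at most as much. -/
def buyManyMenus (m : ℕ) : Set (PriceMenu m) :=
  {p | ∀ A : Strategy m, ∃ ℓ : Lottery m, Dominates ℓ A.outcome ∧ p.price ℓ ≤ A.cost p}

/-! ### Single-buyer mechanisms and the ex ante relaxation -/

/-- A single-buyer mechanism of class `𝒞` for the value distribution `D`: a price menu in `𝒞`
together with a purchase for (almost) every type of the buyer. -/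
structure Mechanism {m : ℕ} (D : Measure (Valuation m)) (𝒞 : Set (PriceMenu m)) where
  menu : PriceMenu m
  menu_mem : menu ∈ 𝒞
  /-- the lottery bought by each type -/
  choice : Valuation m → Lottery m
  isPurchase_choice : ∀ᵐ v ∂D, menu.IsPurchase v (choice v)
  aemeasurable_choice : ∀ S : Finset (Fin m), AEMeasurable (fun v => choice v S) D
  aemeasurable_price : AEMeasurable (fun v => menu.price (choice v)) D

variable {m : ℕ} {D : Measure (Valuation m)} {𝒞 : Set (PriceMenu m)}

/-- The expected revenue of a mechanism. -/
def Mechanism.revenue (M : Mechanism D 𝒞) : ℝ≥0∞ :=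
  ∫⁻ v, M.menu.price (M.choice v) ∂D

/-- The expected allocation of a mechanism: the probability that item `j` is sold. -/
def Mechanism.alloc (M : Mechanism D 𝒞) (j : Fin m) : ℝ≥0∞ :=
  ∫⁻ v, itemProb (M.choice v) j ∂D

/-- The coarsest `σ`-algebra on mechanisms which makes revenue and allocation measurable. -/
instance : MeasurableSpace (Mechanism D 𝒞) :=
  MeasurableSpace.comap (fun M => (M.revenue, M.alloc)) inferInstance

/-- The optimal expected revenue from a buyer with value distribution `D`, over all probability
distributions over mechanisms of class `𝒞` whose expected allocation is at most `x`. -/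
def revEx {m : ℕ} (D : Measure (Valuation m)) (𝒞 : Set (PriceMenu m)) (x : Fin m → ℝ≥0) : ℝ≥0∞ :=
  ⨆ (μ : ProbabilityMeasure (Mechanism D 𝒞))
    (_ : ∀ j, ∫⁻ M, M.alloc j ∂(μ : Measure (Mechanism D 𝒞)) ≤ x j),
    ∫⁻ M, M.revenue ∂(μ : Measure (Mechanism D 𝒞))

/-- The optimal ex ante revenue under the class `𝒞` from `n` buyers with value distributions `D i`:
every item is sold at most once in expectation. -/
def eaRev {n m : ℕ} (D : Fin n → Measure (Valuation m)) (𝒞 : Set (PriceMenu m)) : ℝ≥0∞ :=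
  ⨆ (x : Fin n → Fin m → ℝ≥0) (_ : ∀ j, ∑ i, x i j ≤ 1), ∑ i, revEx (D i) 𝒞 (x i)

/-! ### Sequential item pricing -/

/-- The utility of a buyer who buys the bundle `B` under the item prices `p`. -/
def bundleUtility {m : ℕ} (v : Valuation m) (p : Fin m → ℝ≥0∞) (B : Finset (Fin m)) : ℝ :=
  (v.1 B : ℝ) - (∑ j ∈ B, p j).toReal

/-- `B` is a possible purchase of a buyer with valuation `v` who is offered the items of `A` at item
prices `p`: it is a set of finite price, it maximizes the utility of the buyer, and it has maximal
price among the utility maximizers. An item of price `∞` is never bought. -/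
def IsBundlePurchase {m : ℕ} (v : Valuation m) (A : Finset (Fin m)) (p : Fin m → ℝ≥0∞)
    (B : Finset (Fin m)) : Prop :=
  (B ⊆ A ∧ ∑ j ∈ B, p j ≠ ∞) ∧
  (∀ B' ⊆ A, ∑ j ∈ B', p j ≠ ∞ → bundleUtility v p B' ≤ bundleUtility v p B) ∧
  (∀ B' ⊆ A, ∑ j ∈ B', p j ≠ ∞ → bundleUtility v p B' = bundleUtility v p B →
    ∑ j ∈ B', p j ≤ ∑ j ∈ B, p j)

/-- A rule by which a buyer settles the remaining ties: it picks, measurably, a purchase for every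
valuation, every set of available items and every item pricing. -/
structure PurchaseRule (m : ℕ) where
  buy : Valuation m → Finset (Fin m) → (Fin m → ℝ≥0∞) → Finset (Fin m)
  isBundlePurchase : ∀ v A p, IsBundlePurchase v A p (buy v A p)
  measurable : ∀ A B : Finset (Fin m),
    MeasurableSet {x : Valuation m × (Fin m → ℝ≥0∞) | buy x.1 A x.2 = B}

/-- A (randomized) sequential item pricing for `n` buyers, who arrive in the order `0, 1, …`.
When buyer `i` arrives and `A` is the set of items left over, the mechanism posts an item pricing,
which may depend on its random seed, on `A` and on the valuations of the buyers before `i`. -/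
structure SeqItemPricing (n m : ℕ) where
  Seed : Type
  [seedSpace : MeasurableSpace Seed]
  seedLaw : ProbabilityMeasure Seed
  price : Seed → (Fin n → Valuation m) → Fin n → Finset (Fin m) → Fin m → ℝ≥0∞
  nonanticipating : ∀ ω v w i, (∀ k < i, v k = w k) → price ω v i = price ω w i
  measurable_price : ∀ i A j,
    Measurable fun x : Seed × (Fin n → Valuation m) => price x.1 x.2 i A j

attribute [instance] SeqItemPricing.seedSpace

namespace SeqItemPricing

variable {n m : ℕ} (M : SeqItemPricing n m) (rule : Fin n → PurchaseRule m)
  (ω : M.Seed) (v : Fin n → Valuation m)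

/-- The set of items left over after the first `k` buyers. -/
def remaining : ℕ → Finset (Fin m)
  | 0 => Finset.univ
  | k + 1 =>
    if h : k < n then
      remaining k \ (rule ⟨k, h⟩).buy (v ⟨k, h⟩) (remaining k) (M.price ω v ⟨k, h⟩ (remaining k))
    else remaining k

/-- The item prices posted to buyer `i`. -/
def posted (i : Fin n) : Fin m → ℝ≥0∞ :=
  M.price ω v i (M.remaining rule ω v i)

/-- The bundle bought by buyer `i`. -/
def bundle (i : Fin n) : Finset (Fin m) :=
  (rule i).buy (v i) (M.remaining rule ω v i) (M.posted rule ω v i)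

/-- The payment of buyer `i`. -/
def payment (i : Fin n) : ℝ≥0∞ :=
  ∑ j ∈ M.bundle rule ω v i, M.posted rule ω v i j

/-- The expected revenue from independent buyers with value distributions `D i`. -/
def revenue (D : Fin n → Measure (Valuation m)) : ℝ≥0∞ :=
  ∫⁻ ω, ∫⁻ v, ∑ i, M.payment rule ω v i ∂(Measure.pi D) ∂(M.seedLaw : Measure M.Seed)

end SeqItemPricing

/-- The optimal revenue of sequential item pricing. -/
def seqRev {n m : ℕ} (D : Fin n → Measure (Valuation m)) (rule : Fin n → PurchaseRule m) : ℝ≥0∞ :=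
  ⨆ M : SeqItemPricing n m, M.revenue rule D

end BuyMany

end

/-! Write R for the optimal sequential item pricing revenue and take N = O(log m) price levels that
at most double from one level to the next. A buyer whose utility drops from one level to the next
pays at least that drop at the lower level. So a value is bounded by its price at the lowest level,
the sum of the payments over all levels, and the utility left at the top (`value_le_sum_payments`).
Posting a uniformly random level earns 1/N of that sum, which is one of the two logarithms.

The price p of a purchased lottery is split at 4f times its expected number of items, where f > 2R.
If p is larger, item prices are built from the cheapest price per unit of probability q_j of each
item in the menu. Against a buy-many menu, buying repeatedly until j is drawn costs about q_j, so
the buyer does at least as well as under the prices q (`value_le_unitPrice`). Scaling q down to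
lowest prices that charge the lottery little, and adding the floor f, bounds p by twice the sum of
the payments (`price_le_sum_pay`). All items were assumed available there. This is harmless: with
floor f > 2R, nothing has been sold with probability at least 1/2, since every sale earns f
(`sum_lintegral_pay_univ_le`).

If p is smaller, it lies below the top level of a second pricing, which must respect scarcity. Each
item carries an opportunity cost, starting at ρ, that is multiplied by 1 + (sale probability) after
each buyer and level; the price is this cost plus ρ 2^k. A cost increment is at most the expected
payment for the item, so the costs sum to at most mρ + N R (`sum_cost_le_seqRev`). Compounding makes
the cost at least ρ 2^(N u), where u is the probability that the item is gone
(`mul_two_rpow_le_cost`). For a suitable N these force u ≤ 1/2 (`unavail_costState_le`). A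
subadditive buyer facing such a random set of available items loses only a factor O(H_m) in value
(`subadditive_le_harmonic_mul_sum`), the other logarithm. The lowest-level price of what is sold is
paid for by the ex ante supply constraint: costs only increase, and their final total is controlled.
-/

noncomputable section

namespace BuyMany

/-! ### Values bounded by payments at geometrically growing prices. -/

section Bundles

variable {m : ℕ} {v : Valuation m} {A B S : Finset (Fin m)} {r : Fin m → ℝ≥0∞}

lemma IsBundlePurchase.price_le (h : IsBundlePurchase v A r B) :
    ∑ j ∈ B, r j ≤ (v.1 B : ℝ≥0∞) := by
  have h0 := h.2.1 ∅ (Finset.empty_subset _) (by simp)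
  simp only [bundleUtility, v.2.1, Finset.sum_empty] at h0
  simp only [NNReal.coe_zero, ENNReal.toReal_zero, sub_zero, sub_nonneg] at h0
  rw [← ENNReal.ofReal_toReal h.1.2, ← ENNReal.ofReal_coe_nnreal]
  exact ENNReal.ofReal_le_ofReal h0

lemma IsBundlePurchase.value_le (h : IsBundlePurchase v A r B) (hS : S ⊆ A) :
    (v.1 S : ℝ≥0∞) ≤ ∑ j ∈ S, r j + ((v.1 B : ℝ≥0∞) - ∑ j ∈ B, r j) := by
  by_cases hfin : ∑ j ∈ S, r j = ∞
  · simp [hfin]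
  have h0 := h.2.1 S hS hfin
  simp only [bundleUtility] at h0
  rw [← ENNReal.ofReal_toReal hfin, ← ENNReal.ofReal_toReal h.1.2,
    ← ENNReal.ofReal_coe_nnreal, ← ENNReal.ofReal_coe_nnreal,
    ← ENNReal.ofReal_sub _ ENNReal.toReal_nonneg]
  refine le_trans (ENNReal.ofReal_le_ofReal ?_) ENNReal.ofReal_add_le
  linarith

/-- If prices at most double from one level to the next, then the value of a bundle is bounded by
its price at the lowest level, the payments at all levels below `K`, and the utility at level `K`. -/
lemma value_le_sum_payments {r : ℕ → Fin m → ℝ≥0∞} {B : ℕ → Finset (Fin m)}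
    (hB : ∀ k, IsBundlePurchase v A (r k) (B k)) (hr : ∀ k j, r (k + 1) j ≤ 2 * r k j)
    (K : ℕ) (hS : S ⊆ A) :
    (v.1 S : ℝ≥0∞) ≤ ∑ j ∈ S, r 0 j + ∑ k ∈ Finset.range K, ∑ j ∈ B k, r k j
      + ((v.1 (B K) : ℝ≥0∞) - ∑ j ∈ B K, r K j) := by
  induction K with
  | zero => simpa using (hB 0).value_le hS
  | succ K ih =>
    refine ih.trans ?_
    rw [Finset.sum_range_succ, ← add_assoc, add_assoc (_ + _)]
    gcongr
    -- The bundle bought at level `K` costs at most twice as much at level `K + 1`, so the utility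
    -- drops by at most the payment at level `K`.
    refine tsub_le_iff_left.2 (((hB (K + 1)).value_le (hB K).1.1).trans ?_)
    rw [← add_assoc, ← two_mul, Finset.mul_sum]
    gcongr
    exact hr K _

/-- The sum of the payments at levels `0, …, K`, when every price at level `K` is at least `ρ`. -/
lemma min_value_le_sum_payments {r : ℕ → Fin m → ℝ≥0∞} {B : ℕ → Finset (Fin m)}
    (hB : ∀ k, IsBundlePurchase v A (r k) (B k)) (hr : ∀ k j, r (k + 1) j ≤ 2 * r k j)
    (K : ℕ) {ρ : ℝ≥0∞} (hρ : ∀ j, ρ ≤ r K j) (hS : S ⊆ A) :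
    min (v.1 S : ℝ≥0∞) ρ ≤
      ∑ j ∈ S, r 0 j + ∑ k ∈ Finset.range (K + 1), ∑ j ∈ B k, r k j := by
  -- An empty top bundle leaves no utility at the top; a nonempty one is by itself a payment of at
  -- least `ρ`.
  rcases (B K).eq_empty_or_nonempty with h | ⟨j, hj⟩
  · have := value_le_sum_payments hB hr K hS
    rw [h, v.2.1] at this
    refine (min_le_left _ _).trans (this.trans ?_)
    rw [Finset.sum_range_succ]
    simp [h]
  · refine (min_le_right _ _).trans ?_
    rw [Finset.sum_range_succ]
    rw [← add_assoc]
    exact ((hρ j).trans (Finset.single_le_sum (f := fun j => r K j) (fun _ _ => zero_le) hj)).trans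
      le_add_self

end Bundles

/-! ### Covering by random sets. -/

section Subadditive

variable {m : ℕ}

lemma harmonic_sub_le (a b : ℕ) (hb : b ≤ a) (ha : 0 < a) :
    ((a - b : ℕ) : ℝ) / a ≤ harmonic a - harmonic b := by
  obtain ⟨c, rfl⟩ := Nat.exists_eq_add_of_le hb
  have key : ∀ c, c ≤ b + c → ∀ x : ℝ, (b + c : ℕ) ≤ x → 0 < x →
      (c : ℝ) / x ≤ harmonic (b + c) - harmonic b := by
    intro c
    induction c with
    | zero => intro _ x _ _; simp
    | succ c ih =>
      intro _ x hx hx0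
      have h1 := ih (by omega) x (le_trans (by push_cast; linarith) hx) hx0
      rw [← add_assoc, harmonic_succ]
      push_cast at hx ⊢
      have : 1 / x ≤ ((b : ℝ) + c + 1)⁻¹ := by
        rw [← one_div]
        apply one_div_le_one_div_of_le <;> first | positivity | linarith
      have h2 : ((c : ℝ) + 1) / x = c / x + 1 / x := by ring
      rw [h2]
      linarith
  have := key c (by omega) ((b + c : ℕ) : ℝ) le_rfl (by exact_mod_cast ha)
  simpa using this

/-- Covering by random sets: if every item belongs to the random set with probability at least `1/2`,
then a subadditive function loses at most a factor `4 H_m` on the random set. -/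
lemma subadditive_le_harmonic_mul_sum {g : Finset (Fin m) → ℝ} (hg0 : g ∅ = 0)
    (hgm : Monotone g) (hgs : ∀ S T, g (S ∪ T) ≤ g S + g T)
    {a : Finset (Fin m) → ℝ} (ha : ∀ A, 0 ≤ a A) (ha1 : ∑ A, a A = 1)
    (hav : ∀ j, ∑ A with j ∉ A, a A ≤ 1 / 2) (T : Finset (Fin m)) :
    g T ≤ 4 * harmonic m * ∑ A, a A * g (T ∩ A) := by
  set e := ∑ A, a A * g (T ∩ A) with he
  have gnn : ∀ S, 0 ≤ g S := fun S => hg0 ▸ hgm (Finset.empty_subset S)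
  have he0 : 0 ≤ e := Finset.sum_nonneg fun A _ => mul_nonneg (ha A) (gnn _)
  have hH0 : (0 : ℝ) ≤ harmonic m := by
    rcases Nat.eq_zero_or_pos m with h | h
    · simp [h]
    · exact_mod_cast (harmonic_pos h.ne').le
  -- Greedy set cover, by induction on the uncovered part `U`. The slack `e' > e` makes the
  -- averaging argument strict even if `e = 0`.
  have key : ∀ e' > e, ∀ n, ∀ U ⊆ T, U.card ≤ n → g U ≤ 4 * e' * harmonic U.card := by
    intro e' he' n
    induction n with
    | zero =>
      intro U _ hU
      have : U = ∅ := Finset.card_eq_zero.1 (by omega)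
      simp [this, hg0]
    | succ n ih =>
      intro U hUT hU
      rcases U.eq_empty_or_nonempty with rfl | hne
      · simp [hg0]
      have hc : 0 < U.card := hne.card_pos
      have hcov : (U.card : ℝ) / 2 ≤ ∑ A, a A * (U ∩ A).card := by
        have h1 : ∀ A, a A * ((U ∩ A).card : ℝ) = ∑ j ∈ U, if j ∈ A then a A else 0 := by
          intro A
          rw [← Finset.sum_filter, Finset.filter_mem_eq_inter, Finset.sum_const, nsmul_eq_mul,
            mul_comm]
        simp_rw [h1]
        rw [Finset.sum_comm]
        have h2 : ∀ j ∈ U, (1 : ℝ) / 2 ≤ ∑ A, if j ∈ A then a A else 0 := by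
          intro j _
          rw [← Finset.sum_filter]
          have := Finset.sum_filter_add_sum_filter_not Finset.univ (fun A => j ∈ A) a
          have := hav j
          linarith
        have := Finset.sum_le_sum h2
        simp only [Finset.sum_const, nsmul_eq_mul] at this
        linarith
      -- On average `A` covers half of `U` at cost `e`, so some `A` has cost below `4 * e' / U.card`
      -- per newly covered item.
      obtain ⟨A, hA⟩ : ∃ A, (U.card : ℝ) * g (T ∩ A) < 4 * e' * (U ∩ A).card := by
        by_contra! hcon
        have h1 : ∑ A, a A * (4 * e' * (U ∩ A).card) ≤ ∑ A, a A * (U.card * g (T ∩ A)) :=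
          Finset.sum_le_sum fun A _ => mul_le_mul_of_nonneg_left (hcon A) (ha A)
        have h2 : ∑ A, a A * (4 * e' * (U ∩ A).card) = 4 * e' * ∑ A, a A * (U ∩ A).card := by
          rw [Finset.mul_sum]; exact Finset.sum_congr rfl fun _ _ => by ring
        have h3 : ∑ A, a A * (U.card * g (T ∩ A)) = U.card * e := by
          rw [he, Finset.mul_sum]; exact Finset.sum_congr rfl fun _ _ => by ring
        rw [h2, h3] at h1
        have hc' : (0 : ℝ) < U.card := by exact_mod_cast hc
        have : 0 < e' := lt_of_le_of_lt he0 he'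
        nlinarith [mul_le_mul_of_nonneg_left hcov this.le]
      have hpos : 0 < (U ∩ A).card := by
        rcases Nat.eq_zero_or_pos (U ∩ A).card with h | h
        · rw [h] at hA
          have := mul_nonneg (Nat.cast_nonneg (α := ℝ) U.card) (gnn (T ∩ A))
          simp at hA
          linarith
        · exact h
      have hsplit : (U \ A).card + (U ∩ A).card = U.card := Finset.card_sdiff_add_card_inter U A
      have h1 := ih (U \ A) (Finset.sdiff_subset.trans hUT) (by omega)
      have h2 : g U ≤ g (U \ A) + g (T ∩ A) := by
        calc g U = g (U \ A ∪ U ∩ A) := by rw [Finset.sdiff_union_inter]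
          _ ≤ g (U \ A) + g (U ∩ A) := hgs _ _
          _ ≤ _ := by gcongr; exact hgm (Finset.inter_subset_inter_right hUT)
      have h3 : g (T ∩ A) ≤ 4 * e' * (((U ∩ A).card : ℝ) / U.card) := by
        have hc' : (0 : ℝ) < U.card := by exact_mod_cast hc
        rw [← mul_div_assoc, le_div_iff₀ hc']
        linarith
      -- The drop of the harmonic number from `U` to `U \ A` pays for the newly covered items.
      have h4 := harmonic_sub_le U.card (U \ A).card (by omega) hc
      have h5 : U.card - (U \ A).card = (U ∩ A).card := by omega
      rw [h5] at h4
      have : 0 < e' := lt_of_le_of_lt he0 he'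
      nlinarith [mul_le_mul_of_nonneg_left h4 (by linarith : (0 : ℝ) ≤ 4 * e')]
  have hcard : (harmonic T.card : ℝ) ≤ harmonic m := by
    have h := harmonic_sub_le m T.card (by simpa using T.card_le_univ)
    rcases Nat.eq_zero_or_pos m with h0 | h0
    · have : T.card = 0 := by
        have := T.card_le_univ
        simp at this; omega
      simp [this, h0]
    · have h1 := h h0
      have : (0 : ℝ) ≤ ((m - T.card : ℕ) : ℝ) / m := by positivity
      linarith
  refine le_of_forall_pos_le_add fun ε hε => ?_
  have h1 := key (e + ε / (4 * harmonic m + 1)) (by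
    have : 0 < ε / (4 * harmonic m + 1) := by positivity
    linarith) _ T subset_rfl le_rfl
  have hpos : (0 : ℝ) < 4 * harmonic m + 1 := by positivity
  have h2 : 4 * (harmonic m : ℝ) * (ε / (4 * harmonic m + 1)) ≤ ε := by
    rw [mul_div_assoc', div_le_iff₀ hpos]
    nlinarith
  have h3 : 4 * (e + ε / (4 * harmonic m + 1)) * (harmonic T.card : ℝ)
      ≤ 4 * (e + ε / (4 * harmonic m + 1)) * harmonic m := by
    gcongr
  nlinarith

end Subadditive

/-! ### Independence of a coordinate from the others. -/

section Resampling

variable {n : ℕ} {α : Type*} [MeasurableSpace α] (μ : Fin n → Measure α)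
  [∀ i, IsProbabilityMeasure (μ i)]

/-- A coordinate on which a function does not otherwise depend may be resampled independently. -/
lemma lintegral_pi_resample (i : Fin n) {F : (Fin n → α) → α → ℝ≥0∞}
    (hF : Measurable (Function.uncurry F)) (hi : ∀ x y z, F (Function.update x i y) z = F x z) :
    ∫⁻ x, F x (x i) ∂(Measure.pi μ) = ∫⁻ x, ∫⁻ y, F x y ∂(μ i) ∂(Measure.pi μ) := by
  have hf : Measurable fun x : Fin n → α => F x (x i) :=
    hF.comp (measurable_id.prodMk (measurable_pi_apply i))
  have hg : Measurable fun x : Fin n → α => ∫⁻ y, F x y ∂(μ i) := hF.lintegral_prod_right'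
  -- It suffices that both integrands agree after integrating coordinate `i` alone.
  have h := lmarginal_eq_of_subset (μ := μ) (Finset.subset_univ {i}) hf hg (by
    ext x
    simp [lmarginal_singleton, hi])
  rw [lmarginal_univ, lmarginal_univ] at h
  obtain ⟨y⟩ : Nonempty (Fin n → α) := by
    have : ∀ j, Nonempty α := fun j => (μ j).nonempty_of_neZero
    exact ⟨fun j => (this j).some⟩
  exact congrFun h y

lemma lintegral_pi_comp_eval {ι : Type*} [Fintype ι] [MeasurableSpace ι]
    [MeasurableSingletonClass ι] (i : Fin n) {h : (Fin n → α) → ι} (hh : Measurable h)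
    (hi : ∀ x y, h (Function.update x i y) = h x) {g : ι → α → ℝ≥0∞} (hg : ∀ a, Measurable (g a)) :
    ∫⁻ x, g (h x) (x i) ∂(Measure.pi μ)
      = ∑ a, Measure.pi μ {x | h x = a} * ∫⁻ y, g a y ∂(μ i) := by
  have hu : Measurable (Function.uncurry g) := measurable_from_prod_countable_right hg
  rw [lintegral_pi_resample μ i (F := fun x y => g (h x) y)
    (hu.comp ((hh.comp measurable_fst).prodMk measurable_snd)) (by simp [hi])]
  rw [← lintegral_map (f := fun a => ∫⁻ y, g a y ∂(μ i)) (g := h) (measurable_of_finite _) hh,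
    lintegral_fintype]
  refine Finset.sum_congr rfl fun a _ => ?_
  rw [Measure.map_apply hh (measurableSet_singleton a), mul_comm]
  rfl

end Resampling

section LevelLaw

/-- The uniform distribution on `N` levels. -/
def levelLaw (N : ℕ) : Measure (Fin N) := (N : ℝ≥0∞)⁻¹ • Measure.count

lemma lintegral_levelLaw (N : ℕ) (f : ℕ → ℝ≥0∞) :
    ∫⁻ k, f k ∂(levelLaw N) = (N : ℝ≥0∞)⁻¹ * ∑ k ∈ Finset.range N, f k := by
  rw [levelLaw, lintegral_smul_measure, lintegral_count, tsum_fintype,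
    Fin.sum_univ_eq_sum_range, smul_eq_mul]

instance (N : ℕ) [NeZero N] : IsProbabilityMeasure (levelLaw N) := by
  refine ⟨?_⟩
  have := lintegral_levelLaw N 1
  simp only [Pi.one_apply, lintegral_one, Finset.sum_const, Finset.card_range, nsmul_eq_mul,
    mul_one] at this
  rw [this]
  exact ENNReal.inv_mul_cancel (by simpa using NeZero.ne N) (by simp)

end LevelLaw

/-! ### Random-level pricings and their revenue. -/

section LevelPricing

variable {n m : ℕ}

lemma PurchaseRule.buy_subset (b : PurchaseRule m) (v : Valuation m) (A : Finset (Fin m))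
    (r : Fin m → ℝ≥0∞) : b.buy v A r ⊆ A := (b.isBundlePurchase v A r).1.1

lemma PurchaseRule.measurable_buy (b : PurchaseRule m) (A : Finset (Fin m)) :
    Measurable fun x : Valuation m × (Fin m → ℝ≥0∞) => b.buy x.1 A x.2 :=
  measurable_to_countable' fun B => b.measurable A B

lemma PurchaseRule.measurable_buy_left (b : PurchaseRule m) (A : Finset (Fin m))
    (r : Fin m → ℝ≥0∞) : Measurable fun v : Valuation m => b.buy v A r :=
  (b.measurable_buy A).comp (measurable_id.prodMk measurable_const)

/-- The payment of a buyer who faces item prices `r` for the items of `A`. -/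
def pay (b : PurchaseRule m) (v : Valuation m) (A : Finset (Fin m)) (r : Fin m → ℝ≥0∞) : ℝ≥0∞ :=
  ∑ j ∈ b.buy v A r, r j

lemma measurable_pay (b : PurchaseRule m) (A : Finset (Fin m)) (r : Fin m → ℝ≥0∞) :
    Measurable fun v => pay b v A r :=
  (measurable_of_finite fun B : Finset (Fin m) => ∑ j ∈ B, r j).comp (b.measurable_buy_left A r)

/-- The law of the available items after a buyer who faces the item prices `r k` at a uniformly
random level `k < N`, when `a` is the law of the available items before that buyer. -/
def availStep (b : PurchaseRule m) (D : Measure (Valuation m)) (N : ℕ) (r : ℕ → Fin m → ℝ≥0∞)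
    (a : Finset (Fin m) → ℝ≥0∞) (A' : Finset (Fin m)) : ℝ≥0∞ :=
  ∑ A, a A * ((N : ℝ≥0∞)⁻¹ * ∑ k ∈ Finset.range N, D {v | A \ b.buy v A (r k) = A'})

variable (D : Fin n → Measure (Valuation m)) (rule : Fin n → PurchaseRule m) (N : ℕ)
  (r : Fin n → ℕ → Fin m → ℝ≥0∞)

/-- The law of the available items after the first `i` buyers, if buyer `i` faces the item prices
`r i k` at a uniformly random level `k < N`. -/
def availLaw : ℕ → Finset (Fin m) → ℝ≥0∞
  | 0 => Pi.single Finset.univ 1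
  | i + 1 => if h : i < n then
      availStep (rule ⟨i, h⟩) (D ⟨i, h⟩) N (r ⟨i, h⟩) (availLaw i)
    else availLaw i

/-- The sequential item pricing that posts the prices `r i k` to buyer `i`, where the level `k` is
uniformly random and independent for all buyers. -/
def levelPricing [NeZero N] : SeqItemPricing n m where
  Seed := Fin n → Fin N
  seedLaw := ⟨Measure.pi fun _ => levelLaw N, inferInstance⟩
  price ω _ i _ j := r i (ω i) j
  nonanticipating _ _ _ _ _ := rfl
  measurable_price i _ j :=
    (measurable_of_finite fun ω : Fin n → Fin N => r i (ω i) j).comp measurable_fst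

lemma measurable_level_buy (b : PurchaseRule m) (A : Finset (Fin m)) (r : ℕ → Fin m → ℝ≥0∞) :
    Measurable fun x : Fin N × Valuation m => b.buy x.2 A (r x.1) :=
  (b.measurable_buy A).comp
    (measurable_snd.prodMk ((measurable_of_finite fun k : Fin N => r k).comp measurable_fst))

lemma lintegral_levelLaw_prod (D : Measure (Valuation m)) [IsProbabilityMeasure D]
    {g : ℕ → Valuation m → ℝ≥0∞} (hg : ∀ k, Measurable (g k)) :
    ∫⁻ y : Fin N × Valuation m, g y.1 y.2 ∂((levelLaw N).prod D)
      = (N : ℝ≥0∞)⁻¹ * ∑ k ∈ Finset.range N, ∫⁻ v, g k v ∂D := by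
  rw [lintegral_prod]
  · exact lintegral_levelLaw N fun k => ∫⁻ v, g k v ∂D
  · exact Measurable.aemeasurable (measurable_from_prod_countable_right fun k : Fin N => hg k)

variable [NeZero N]

lemma remaining_congr {ω ω' : Fin n → Fin N} {v v' : Fin n → Valuation m} (k : ℕ)
    (h : ∀ i : Fin n, (i : ℕ) < k → ω i = ω' i ∧ v i = v' i) :
    (levelPricing N r).remaining rule ω v k = (levelPricing N r).remaining rule ω' v' k := by
  induction k with
  | zero => rfl
  | succ k ih =>
    have ih' := ih fun i hi => h i (by omega)
    simp only [SeqItemPricing.remaining]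
    split_ifs with hk
    · obtain ⟨h1, h2⟩ := h ⟨k, hk⟩ (Nat.lt_succ_self k)
      simp only [levelPricing] at ih' ⊢
      rw [ih', h1, h2]
    · exact ih'

lemma measurable_remaining (k : ℕ) :
    Measurable fun x : Fin n → Fin N × Valuation m =>
      (levelPricing N r).remaining rule (fun i => (x i).1) (fun i => (x i).2) k := by
  induction k with
  | zero => exact measurable_const
  | succ k ih =>
    by_cases hk : k < n
    · simp only [SeqItemPricing.remaining, dif_pos hk]
      have hu : Measurable (Function.uncurry fun (A : Finset (Fin m)) (y : Fin N × Valuation m) =>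
          A \ (rule ⟨k, hk⟩).buy y.2 A (r ⟨k, hk⟩ y.1)) :=
        measurable_from_prod_countable_right fun A =>
          (measurable_of_finite fun B : Finset (Fin m) => A \ B).comp (measurable_level_buy N _ A _)
      exact hu.comp (ih.prodMk (measurable_pi_apply ⟨k, hk⟩))
    · simpa only [SeqItemPricing.remaining, dif_neg hk] using ih

variable [∀ i, IsProbabilityMeasure (D i)]

/-- The items left before buyer `i` depend only on the levels and valuations of earlier buyers,
hence are independent of those of buyer `i`. -/
lemma lintegral_comp_remaining (i : Fin n) {g : Finset (Fin m) → ℕ → Valuation m → ℝ≥0∞}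
    (hg : ∀ A k, Measurable (g A k)) :
    ∫⁻ x, g ((levelPricing N r).remaining rule (fun i => (x i).1) (fun i => (x i).2) i)
        (x i).1 (x i).2 ∂(Measure.pi fun i => (levelLaw N).prod (D i))
      = ∑ A, Measure.pi (fun i => (levelLaw N).prod (D i))
          {x | (levelPricing N r).remaining rule (fun i => (x i).1) (fun i => (x i).2) i = A}
        * ((N : ℝ≥0∞)⁻¹ * ∑ k ∈ Finset.range N, ∫⁻ v, g A k v ∂(D i)) := by
  have h := lintegral_pi_comp_eval (fun i => (levelLaw N).prod (D i)) i
    (measurable_remaining rule N r i) (g := fun A y => g A y.1 y.2) (fun x y => by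
      refine remaining_congr rule N r i fun l hl => ?_
      have : l ≠ i := fun h => by simp [h] at hl
      simp [Function.update_of_ne this]) (fun A => measurable_from_prod_countable_right
        fun k : Fin N => hg A k)
  rw [h]
  simp only [lintegral_levelLaw_prod N (D i) (hg _)]

/-- The available set is a Markov chain, because every buyer brings a fresh level and valuation;
`availStep` is its transition. -/
lemma measure_remaining_eq (k : ℕ) (A : Finset (Fin m)) :
    Measure.pi (fun i => (levelLaw N).prod (D i))
      {x | (levelPricing N r).remaining rule (fun i => (x i).1) (fun i => (x i).2) k = A}
      = availLaw D rule N r k A := by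
  induction k generalizing A with
  | zero =>
    simp only [SeqItemPricing.remaining, availLaw, Pi.single_apply]
    split_ifs with h
    · simp [h]
    · simp [Ne.symm h]
  | succ k ih =>
    by_cases hk : k < n
    · have hms : ∀ A' l, MeasurableSet {v | A' \ (rule ⟨k, hk⟩).buy v A' (r ⟨k, hk⟩ l) = A} :=
        fun A' l => ((measurable_of_finite fun B : Finset (Fin m) => A' \ B).comp
          ((rule ⟨k, hk⟩).measurable_buy_left A' (r ⟨k, hk⟩ l))) (measurableSet_singleton A)
      have h := lintegral_comp_remaining D rule N r ⟨k, hk⟩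
        (g := fun A' l => Set.indicator {v | A' \ (rule ⟨k, hk⟩).buy v A' (r ⟨k, hk⟩ l) = A} 1)
        (fun A' l => measurable_one.indicator (hms A' l))
      simp only [lintegral_indicator_one (hms _ _), ih] at h
      simp only [availLaw, dif_pos hk, availStep]
      rw [← h, ← lintegral_indicator_one]
      · refine lintegral_congr fun x => ?_
        simp only [SeqItemPricing.remaining, dif_pos hk]
        rfl
      · exact measurable_remaining rule N r (k + 1) (measurableSet_singleton A)
    · simpa only [SeqItemPricing.remaining, availLaw, dif_neg hk] using ih A

/-- The expected revenue of a level pricing, in terms of the law of the available items. -/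
theorem revenue_levelPricing :
    (levelPricing N r).revenue rule D = ∑ i : Fin n, ∑ A, availLaw D rule N r i A *
      ((N : ℝ≥0∞)⁻¹ * ∑ k ∈ Finset.range N, ∫⁻ v, pay (rule i) v A (r i k) ∂(D i)) := by
  have hpay : ∀ (x : Fin n → Fin N × Valuation m) i,
      (levelPricing N r).payment rule (fun i => (x i).1) (fun i => (x i).2) i =
      pay (rule i) (x i).2
        ((levelPricing N r).remaining rule (fun i => (x i).1) (fun i => (x i).2) i)
        (r i (x i).1) := fun _ _ => rfl
  have hmeas : ∀ i, Measurable fun x : Fin n → Fin N × Valuation m =>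
      (levelPricing N r).payment rule (fun i => (x i).1) (fun i => (x i).2) i := by
    intro i
    simp only [hpay]
    have hu : Measurable (Function.uncurry fun (A : Finset (Fin m)) (y : Fin N × Valuation m) =>
        pay (rule i) y.2 A (r i y.1)) :=
      measurable_from_prod_countable_right fun A =>
        measurable_from_prod_countable_right fun k : Fin N => measurable_pay (rule i) A (r i k)
    exact hu.comp ((measurable_remaining rule N r i).prodMk (measurable_pi_apply i))
  have hsum : Measurable fun x : Fin n → Fin N × Valuation m => ∑ i,
      (levelPricing N r).payment rule (fun i => (x i).1) (fun i => (x i).2) i :=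
    Finset.measurable_sum _ fun i _ => hmeas i
  -- Levels and valuations are regrouped into one independent pair per buyer.
  have hmp := measurePreserving_arrowProdEquivProdArrow (Fin N) (Valuation m) (Fin n)
    (fun _ => levelLaw N) D
  have h1 : (levelPricing N r).revenue rule D = ∫⁻ z : (Fin n → Fin N) × (Fin n → Valuation m),
      ∑ i, (levelPricing N r).payment rule z.1 z.2 i
        ∂((Measure.pi fun _ => levelLaw N).prod (Measure.pi D)) := by
    rw [lintegral_prod]
    · rfl
    · exact (hsum.comp (MeasurableEquiv.arrowProdEquivProdArrow _ _ _).symm.measurable).aemeasurable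
  rw [h1, ← hmp.lintegral_comp_emb (MeasurableEquiv.measurableEmbedding _)]
  change ∫⁻ x : Fin n → Fin N × Valuation m, ∑ i, (levelPricing N r).payment rule (fun i => (x i).1) (fun i => (x i).2) i ∂_ = _
  rw [lintegral_finsetSum _ fun i _ => hmeas i]
  refine Finset.sum_congr rfl fun i _ => ?_
  simp only [hpay]
  rw [lintegral_comp_remaining D rule N r i (g := fun A k v => pay (rule i) v A (r i k))
    (fun A k => measurable_pay _ _ _)]
  simp only [measure_remaining_eq]

theorem levelPricing_le_seqRev :
    ∑ i : Fin n, ∑ A, availLaw D rule N r i A *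
      ((N : ℝ≥0∞)⁻¹ * ∑ k ∈ Finset.range N, ∫⁻ v, pay (rule i) v A (r i k) ∂(D i))
      ≤ seqRev D rule := by
  rw [← revenue_levelPricing]
  exact le_iSup (fun M : SeqItemPricing n m => M.revenue rule D) (levelPricing N r)

end LevelPricing

/-! ### How one buyer changes the law of the available items. -/

section AvailabilityLaw

variable {m : ℕ} (b : PurchaseRule m) (D : Measure (Valuation m))

/-- The probability that item `j` is sold to a buyer who faces the item prices `r`, when `a` is the
law of the available items. -/
def soldProb (a : Finset (Fin m) → ℝ≥0∞) (r : Fin m → ℝ≥0∞) (j : Fin m) : ℝ≥0∞ :=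
  ∑ A, a A * D {v | j ∈ b.buy v A r}

lemma lintegral_pay (A : Finset (Fin m)) (r : Fin m → ℝ≥0∞) :
    ∫⁻ v, pay b v A r ∂D = ∑ j, r j * D {v | j ∈ b.buy v A r} := by
  have hms : ∀ j, MeasurableSet {v | j ∈ b.buy v A r} := fun j =>
    b.measurable_buy_left A r (measurableSet_mem_finset j)
  have : ∀ v, pay b v A r = ∑ j, r j * Set.indicator {v | j ∈ b.buy v A r} 1 v := by
    intro v
    simp only [pay, Set.indicator_apply, Set.mem_ofPred_eq, Pi.one_apply, mul_ite, mul_one,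
      mul_zero, Finset.sum_ite_mem, Finset.univ_inter]
  simp_rw [this]
  rw [lintegral_finsetSum _ fun j _ => (measurable_one.indicator (hms j)).const_mul _]
  refine Finset.sum_congr rfl fun j _ => ?_
  rw [lintegral_const_mul _ (measurable_one.indicator (hms j)), lintegral_indicator_one (hms j)]

lemma sum_mul_lintegral_pay (a : Finset (Fin m) → ℝ≥0∞) (r : Fin m → ℝ≥0∞) :
    ∑ A, a A * ∫⁻ v, pay b v A r ∂D = ∑ j, r j * soldProb b D a r j := by
  simp_rw [lintegral_pay, soldProb, Finset.mul_sum]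
  rw [Finset.sum_comm]
  exact Finset.sum_congr rfl fun _ _ => Finset.sum_congr rfl fun _ _ => by ring

/-- The transition tested against `φ`. It is used with the constant 1 (total mass), the indicator
that an item is missing, and the indicator that anything is missing. -/
lemma sum_availStep_mul (N : ℕ) (r : ℕ → Fin m → ℝ≥0∞) (a φ : Finset (Fin m) → ℝ≥0∞) :
    ∑ A', availStep b D N r a A' * φ A' = ∑ A, a A * ((N : ℝ≥0∞)⁻¹ *
      ∑ k ∈ Finset.range N, ∫⁻ v, φ (A \ b.buy v A (r k)) ∂D) := by
  have h : ∀ A k, ∫⁻ v, φ (A \ b.buy v A (r k)) ∂D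
      = ∑ A', D {v | A \ b.buy v A (r k) = A'} * φ A' := by
    intro A k
    have hm : Measurable fun v => A \ b.buy v A (r k) :=
      (measurable_of_finite fun B : Finset (Fin m) => A \ B).comp (b.measurable_buy_left A (r k))
    rw [← lintegral_map (f := φ) (measurable_of_finite _) hm, lintegral_fintype]
    refine Finset.sum_congr rfl fun A' _ => ?_
    rw [Measure.map_apply hm (measurableSet_singleton A'), mul_comm]
    rfl
  simp_rw [h, availStep, Finset.sum_mul]
  rw [Finset.sum_comm]
  refine Finset.sum_congr rfl fun A _ => ?_
  rw [Finset.sum_comm, Finset.mul_sum, Finset.mul_sum]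
  refine Finset.sum_congr rfl fun A' _ => ?_
  rw [mul_assoc, mul_assoc, Finset.sum_mul]

variable [IsProbabilityMeasure D]

lemma inv_mul_sum_range_one (N : ℕ) [NeZero N] (x : ℝ≥0∞) :
    (N : ℝ≥0∞)⁻¹ * ∑ _k ∈ Finset.range N, x = x := by
  rw [Finset.sum_const, Finset.card_range, nsmul_eq_mul, ← mul_assoc,
    ENNReal.inv_mul_cancel (by simpa using NeZero.ne N) (by simp), one_mul]

lemma sum_availStep (N : ℕ) [NeZero N] (r : ℕ → Fin m → ℝ≥0∞) (a : Finset (Fin m) → ℝ≥0∞) :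
    ∑ A, availStep b D N r a A = ∑ A, a A := by
  have h := sum_availStep_mul b D N r a 1
  simp only [Pi.one_apply, mul_one, lintegral_one, measure_univ, inv_mul_sum_range_one] at h
  exact h

/-- The probability that item `j` is not available. -/
def unavail (a : Finset (Fin m) → ℝ≥0∞) (j : Fin m) : ℝ≥0∞ := ∑ A with j ∉ A, a A

lemma unavail_availStep (N : ℕ) [NeZero N] (r : ℕ → Fin m → ℝ≥0∞) (a : Finset (Fin m) → ℝ≥0∞)
    (j : Fin m) : unavail (availStep b D N r a) j =
      unavail a j + (N : ℝ≥0∞)⁻¹ * ∑ k ∈ Finset.range N, soldProb b D a (r k) j := by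
  have h := sum_availStep_mul b D N r a (fun A => if j ∈ A then 0 else 1)
  have h1 : ∀ a : Finset (Fin m) → ℝ≥0∞, unavail a j = ∑ A, a A * (if j ∈ A then 0 else 1) := by
    intro a
    simp only [unavail, Finset.sum_filter, mul_ite, mul_zero, mul_one, ite_not]
  rw [h1, h, h1]
  have h2 : ∀ A k, ∫⁻ v, (if j ∈ A \ b.buy v A (r k) then (0 : ℝ≥0∞) else 1) ∂D
      = (if j ∈ A then 0 else 1) + D {v | j ∈ b.buy v A (r k)} := by
    intro A k
    have hms : MeasurableSet {v | j ∈ b.buy v A (r k)} :=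
      b.measurable_buy_left A (r k) (measurableSet_mem_finset j)
    by_cases hj : j ∈ A
    · simp only [hj, if_true, zero_add]
      rw [← lintegral_indicator_one hms]
      refine lintegral_congr fun v => ?_
      by_cases hv : j ∈ b.buy v A (r k) <;> simp [hj, hv]
    · have : {v | j ∈ b.buy v A (r k)} = ∅ := by
        ext v
        simpa using fun hv => hj (b.buy_subset v A (r k) hv)
      simp [hj, this]
  simp_rw [h2, Finset.sum_add_distrib, mul_add, inv_mul_sum_range_one, Finset.sum_add_distrib,
    soldProb]
  congr 1
  rw [Finset.sum_comm, Finset.mul_sum]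
  refine Finset.sum_congr rfl fun A _ => ?_
  rw [Finset.mul_sum, Finset.mul_sum, Finset.mul_sum]
  exact Finset.sum_congr rfl fun k _ => by ring

/-- The probability that some item has been sold grows by at most the probability of a sale. -/
lemma availStep_ne_univ_le (N : ℕ) [NeZero N] (r : ℕ → Fin m → ℝ≥0∞)
    (a : Finset (Fin m) → ℝ≥0∞) {f : ℝ≥0∞} (hr : ∀ k j, f ≤ r k j) :
    f * ∑ A with A ≠ Finset.univ, availStep b D N r a A ≤
      f * ∑ A with A ≠ Finset.univ, a A + ∑ A, a A *
        ((N : ℝ≥0∞)⁻¹ * ∑ k ∈ Finset.range N, ∫⁻ v, pay b v A (r k) ∂D) := by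
  have h := sum_availStep_mul b D N r a (fun A => if A ≠ Finset.univ then 1 else 0)
  have h1 : ∀ a : Finset (Fin m) → ℝ≥0∞, ∑ A with A ≠ Finset.univ, a A
      = ∑ A, a A * (if A ≠ Finset.univ then 1 else 0) := by
    intro a
    simp only [Finset.sum_filter, mul_ite, mul_zero, mul_one]
  rw [h1, h, h1, Finset.mul_sum, Finset.mul_sum, ← Finset.sum_add_distrib]
  refine Finset.sum_le_sum fun A _ => ?_
  have h2 : ∀ k, f * ∫⁻ v, (if A \ b.buy v A (r k) ≠ Finset.univ then (1 : ℝ≥0∞) else 0) ∂D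
      ≤ f * (if A ≠ Finset.univ then 1 else 0) + ∫⁻ v, pay b v A (r k) ∂D := by
    intro k
    -- Only a first sale counts: from the full set, leaving it needs a purchase, which pays at least
    -- `f`.
    by_cases hA : A = Finset.univ
    · simp only [hA, ne_eq, not_true_eq_false, if_false, mul_zero, zero_add]
      rw [← lintegral_const_mul f]
      · refine lintegral_mono fun v => ?_
        rcases (b.buy v Finset.univ (r k)).eq_empty_or_nonempty with h | ⟨j, hj⟩
        · simp [h]
        · refine le_trans (b := f) ?_ ((hr k j).trans
            (Finset.single_le_sum (f := fun j => r k j) (fun _ _ => zero_le) hj))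
          split_ifs <;> simp
      · exact (measurable_of_finite fun B : Finset (Fin m) =>
          if ¬ Finset.univ \ B = Finset.univ then (1 : ℝ≥0∞) else 0).comp
            (b.measurable_buy_left Finset.univ (r k))
    · refine le_trans ?_ le_self_add
      gcongr
      refine (lintegral_mono (g := fun _ => 1) fun v => ?_).trans (by simp [hA])
      split_ifs <;> simp
  calc f * (a A * ((N : ℝ≥0∞)⁻¹ * ∑ k ∈ Finset.range N,
        ∫⁻ v, (if A \ b.buy v A (r k) ≠ Finset.univ then (1 : ℝ≥0∞) else 0) ∂D))
      = a A * ((N : ℝ≥0∞)⁻¹ * ∑ k ∈ Finset.range N,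
        f * ∫⁻ v, (if A \ b.buy v A (r k) ≠ Finset.univ then (1 : ℝ≥0∞) else 0) ∂D) := by
        rw [← Finset.mul_sum]; ring
    _ ≤ a A * ((N : ℝ≥0∞)⁻¹ * ∑ k ∈ Finset.range N,
        (f * (if A ≠ Finset.univ then 1 else 0) + ∫⁻ v, pay b v A (r k) ∂D)) := by
        gcongr with k hk
        exact h2 k
    _ = _ := by
        rw [Finset.sum_add_distrib, mul_add, inv_mul_sum_range_one]; ring

end AvailabilityLaw

/-! ### Compounding opportunity costs within one buyer. -/

section Growth

/-- A compounding factor of `1 + x` beats the exponential `2 ^ x` on the unit interval. -/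
lemma two_rpow_le_one_add {x : ℝ≥0∞} (hx : x ≤ 1) : (2 : ℝ≥0∞) ^ x.toReal ≤ 1 + x := by
  lift x to ℝ≥0 using ne_top_of_le_ne_top ENNReal.one_ne_top hx
  have hx' : (x : ℝ) ≤ 1 := by exact_mod_cast hx
  have h := rpow_one_add_le_one_add_mul_self (s := 1) (by norm_num) x.2 hx'
  have h' : ((2 : ℝ≥0) ^ (x : ℝ) : ℝ≥0) ≤ 1 + x := by
    rw [← NNReal.coe_le_coe]
    push_cast
    norm_num at h
    exact h
  rw [ENNReal.coe_toReal]
  calc (2 : ℝ≥0∞) ^ (x : ℝ) = (((2 : ℝ≥0) ^ (x : ℝ) : ℝ≥0) : ℝ≥0∞) := by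
        rw [ENNReal.coe_rpow_of_nonneg _ x.coe_nonneg]; rfl
    _ ≤ _ := by exact_mod_cast h'

variable {m : ℕ} (b : PurchaseRule m) (D : Measure (Valuation m)) (ρ : ℝ≥0∞)
  (a : Finset (Fin m) → ℝ≥0∞) (c : Fin m → ℝ≥0∞)

/-- The opportunity cost of item `j` at level `k`: it grows from each level to the next by the
probability that the item is sold at that level. -/
def levelCost : ℕ → Fin m → ℝ≥0∞
  | 0, j => c j
  | k + 1, j => levelCost k j * (1 + soldProb b D a (fun j => levelCost k j + ρ * 2 ^ k) j)

/-- The price of item `j` at level `k`. -/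
def levelPrice (k : ℕ) (j : Fin m) : ℝ≥0∞ := levelCost b D ρ a c k j + ρ * 2 ^ k

lemma levelCost_eq (k : ℕ) (j : Fin m) : levelCost b D ρ a c k j = c j + ∑ l ∈ Finset.range k,
    levelCost b D ρ a c l j * soldProb b D a (levelPrice b D ρ a c l) j := by
  induction k with
  | zero => simp [levelCost]
  | succ k ih =>
    rw [Finset.sum_range_succ, ← add_assoc, ← ih, levelCost, mul_add, mul_one]
    rfl

variable {a} [IsProbabilityMeasure D]

lemma soldProb_le_one (ha : ∑ A, a A = 1) (r : Fin m → ℝ≥0∞) (j : Fin m) :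
    soldProb b D a r j ≤ 1 := by
  calc soldProb b D a r j ≤ ∑ A, a A * 1 := by
        unfold soldProb; gcongr; exact prob_le_one
    _ = 1 := by simpa using ha

/-- The compounding factor is at most 2 because a sale probability is at most 1; the other summand
doubles exactly. -/
lemma levelPrice_succ_le (ha : ∑ A, a A = 1) (k : ℕ) (j : Fin m) :
    levelPrice b D ρ a c (k + 1) j ≤ 2 * levelPrice b D ρ a c k j := by
  simp only [levelPrice, levelCost]
  calc _ ≤ levelCost b D ρ a c k j * (1 + 1) + ρ * 2 ^ (k + 1) := by
        gcongr; exact soldProb_le_one b D ha _ j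
    _ = _ := by ring

lemma mul_two_rpow_le_levelCost (ha : ∑ A, a A = 1) (k : ℕ) (j : Fin m) :
    c j * 2 ^ (∑ l ∈ Finset.range k, soldProb b D a (levelPrice b D ρ a c l) j).toReal
      ≤ levelCost b D ρ a c k j := by
  have hfin : ∀ l, soldProb b D a (levelPrice b D ρ a c l) j ≠ ∞ := fun l =>
    ne_top_of_le_ne_top ENNReal.one_ne_top (soldProb_le_one b D ha _ j)
  induction k with
  | zero => simp [levelCost]
  | succ k ih =>
    rw [Finset.sum_range_succ, ENNReal.toReal_add (ENNReal.sum_ne_top.2 fun l _ => hfin l) (hfin k),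
      ENNReal.rpow_add _ _ (by norm_num) (by norm_num), ← mul_assoc]
    exact mul_le_mul' ih (two_rpow_le_one_add (soldProb_le_one b D ha _ j))

end Growth

/-! ### Costs across all buyers: an upper bound by revenue, a lower bound by unavailability. -/

section CompoundingPrices

variable {n m : ℕ} (D : Fin n → Measure (Valuation m)) (rule : Fin n → PurchaseRule m) (N : ℕ)
  (ρ : ℝ≥0∞)

/-- The law of the available items and the opportunity costs after the first `i` buyers. -/
def costState : ℕ → (Finset (Fin m) → ℝ≥0∞) × (Fin m → ℝ≥0∞)
  | 0 => (Pi.single Finset.univ 1, fun _ => ρ)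
  | i + 1 => if h : i < n then
      (availStep (rule ⟨i, h⟩) (D ⟨i, h⟩) N
        (levelPrice (rule ⟨i, h⟩) (D ⟨i, h⟩) ρ (costState i).1 (costState i).2) (costState i).1,
        levelCost (rule ⟨i, h⟩) (D ⟨i, h⟩) ρ (costState i).1 (costState i).2 N)
    else costState i

/-- The prices posted to buyer `i` at level `k`. -/
def costPrice (i : Fin n) : ℕ → Fin m → ℝ≥0∞ :=
  levelPrice (rule i) (D i) ρ (costState D rule N ρ i).1 (costState D rule N ρ i).2

lemma availLaw_costPrice (i : ℕ) :
    availLaw D rule N (costPrice D rule N ρ) i = (costState D rule N ρ i).1 := by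
  induction i with
  | zero => rfl
  | succ i ih =>
    by_cases h : i < n
    · simp only [availLaw, costState, dif_pos h, ih]
      rfl
    · simp only [availLaw, costState, dif_neg h, ih]

lemma costState_mono {i k : ℕ} (h : i ≤ k) (j : Fin m) :
    (costState D rule N ρ i).2 j ≤ (costState D rule N ρ k).2 j := by
  induction k, h using Nat.le_induction with
  | base => exact le_rfl
  | succ k _ ih =>
    refine ih.trans ?_
    by_cases h : k < n
    · simp only [costState, dif_pos h]
      rw [levelCost_eq]
      exact le_self_add
    · simp only [costState, dif_neg h, le_refl]

variable [NeZero N]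

/-- The opportunity costs grow at most as fast as the revenue. -/
lemma sum_cost_le (k : ℕ) (hk : k ≤ n) : ∑ j, (costState D rule N ρ k).2 j ≤
    m * ρ + N * ∑ i ∈ Finset.univ.filter (fun i : Fin n => (i : ℕ) < k), ∑ A, (costState D rule N ρ i).1 A * ((N : ℝ≥0∞)⁻¹ *
      ∑ l ∈ Finset.range N, ∫⁻ v, pay (rule i) v A (costPrice D rule N ρ i l) ∂(D i)) := by
  induction k with
  | zero => simp [costState]
  | succ k ih =>
    have h : k < n := hk
    have hfil : Finset.univ.filter (fun i : Fin n => (i : ℕ) < k + 1)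
        = insert ⟨k, h⟩ (Finset.univ.filter fun i : Fin n => (i : ℕ) < k) := by
      ext i
      simp only [Finset.mem_filter, Finset.mem_univ, true_and, Finset.mem_insert, Fin.ext_iff]
      omega
    rw [hfil, Finset.sum_insert (by simp), mul_add]
    refine le_trans ?_ (b := ∑ j, (costState D rule N ρ k).2 j + N * ∑ A,
      (costState D rule N ρ k).1 A * ((N : ℝ≥0∞)⁻¹ * ∑ l ∈ Finset.range N,
        ∫⁻ v, pay (rule ⟨k, h⟩) v A (costPrice D rule N ρ ⟨k, h⟩ l) ∂(D ⟨k, h⟩))) ?_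
    · simp only [costState, dif_pos h]
      simp_rw [levelCost_eq (k := N)]
      rw [Finset.sum_add_distrib]
      gcongr ?_ + ?_
      · exact le_rfl
      have hN : (N : ℝ≥0∞) * (N : ℝ≥0∞)⁻¹ = 1 :=
        ENNReal.mul_inv_cancel (by simpa using NeZero.ne N) (by simp)
      have : (N : ℝ≥0∞) * ∑ A, (costState D rule N ρ k).1 A * ((N : ℝ≥0∞)⁻¹ *
          ∑ l ∈ Finset.range N,
            ∫⁻ v, pay (rule ⟨k, h⟩) v A (costPrice D rule N ρ ⟨k, h⟩ l) ∂(D ⟨k, h⟩))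
          = ∑ l ∈ Finset.range N, ∑ j, costPrice D rule N ρ ⟨k, h⟩ l j *
            soldProb (rule ⟨k, h⟩) (D ⟨k, h⟩) (costState D rule N ρ k).1
              (costPrice D rule N ρ ⟨k, h⟩ l) j := by
        simp_rw [← sum_mul_lintegral_pay, Finset.mul_sum]
        rw [Finset.sum_comm]
        refine Finset.sum_congr rfl fun l _ => Finset.sum_congr rfl fun A _ => ?_
        calc _ = ((N : ℝ≥0∞) * (N : ℝ≥0∞)⁻¹) * ((costState D rule N ρ k).1 A *
              ∫⁻ v, pay (rule ⟨k, h⟩) v A (costPrice D rule N ρ ⟨k, h⟩ l) ∂(D ⟨k, h⟩)) := by ring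
          _ = _ := by rw [hN, one_mul]
      rw [this, Finset.sum_comm]
      refine Finset.sum_le_sum fun l _ => Finset.sum_le_sum fun j _ => ?_
      -- The cost is a summand of the price, so each cost increment is at most the expected payment
      -- for the item at that level.
      exact mul_le_mul' le_self_add le_rfl
    · rw [add_left_comm, add_comm]
      gcongr
      exact ih h.le

variable [∀ i, IsProbabilityMeasure (D i)]

lemma sum_availLaw (r : Fin n → ℕ → Fin m → ℝ≥0∞) (i : ℕ) :
    ∑ A, availLaw D rule N r i A = 1 := by
  induction i with
  | zero => simp [availLaw]
  | succ i ih =>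
    by_cases h : i < n
    · simp only [availLaw, dif_pos h, sum_availStep, ih]
    · simp only [availLaw, dif_neg h, ih]

lemma sum_costState (i : ℕ) : ∑ A, (costState D rule N ρ i).1 A = 1 := by
  rw [← availLaw_costPrice]
  exact sum_availLaw D rule N _ i

/-- A buyer raises the unavailability by the average of the sale probabilities over the `N` levels,
so `N` times it grows by their sum, the exponent gained by the cost. -/
lemma mul_two_rpow_le_cost (i : ℕ) (j : Fin m) :
    ρ * 2 ^ (N * (unavail (costState D rule N ρ i).1 j).toReal) ≤ (costState D rule N ρ i).2 j := by
  induction i with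
  | zero =>
    have : unavail (costState D rule N ρ 0).1 j = 0 := by
      simp only [unavail, costState]
      refine Finset.sum_eq_zero fun A hA => ?_
      have : A ≠ Finset.univ := by
        rintro rfl
        simp at hA
      simp [this]
    rw [this]
    simp [costState]
  | succ i ih =>
    by_cases h : i < n
    · simp only [costState, dif_pos h, unavail_availStep]
      refine le_trans ?_ (mul_two_rpow_le_levelCost _ _ _ _ (sum_costState D rule N ρ i) N j)
      refine le_trans (le_of_eq ?_) (mul_le_mul' ih le_rfl)
      have hs : ∑ l ∈ Finset.range N, soldProb (rule ⟨i, h⟩) (D ⟨i, h⟩) (costState D rule N ρ i).1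
          (levelPrice (rule ⟨i, h⟩) (D ⟨i, h⟩) ρ (costState D rule N ρ i).1
            (costState D rule N ρ i).2 l) j ≠ ∞ :=
        ENNReal.sum_ne_top.2 fun l _ => ne_top_of_le_ne_top ENNReal.one_ne_top
          (soldProb_le_one _ _ (sum_costState D rule N ρ i) _ j)
      have hu : unavail (costState D rule N ρ i).1 j ≠ ∞ := by
        refine ne_top_of_le_ne_top ENNReal.one_ne_top ?_
        rw [← sum_costState D rule N ρ i]
        exact Finset.sum_le_sum_of_subset (Finset.filter_subset _ _)
      rw [mul_assoc, ← ENNReal.rpow_add _ _ (by norm_num) (by norm_num),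
        ENNReal.toReal_add hu (ENNReal.mul_ne_top (by simpa using NeZero.ne N) hs),
        ENNReal.toReal_mul, mul_add, ENNReal.toReal_inv, ENNReal.toReal_natCast, ← mul_assoc,
        mul_inv_cancel₀ (by exact_mod_cast NeZero.ne N), one_mul]
    · simpa only [costState, dif_neg h] using ih

/-- The total opportunity cost is bounded in terms of the optimal revenue. -/
theorem sum_cost_le_seqRev (i : ℕ) (hi : i ≤ n) :
    ∑ j, (costState D rule N ρ i).2 j ≤ m * ρ + N * seqRev D rule := by
  refine (Finset.sum_le_sum fun j _ => costState_mono D rule N ρ hi j).trans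
    ((sum_cost_le D rule N ρ n le_rfl).trans ?_)
  gcongr
  refine le_trans (Finset.sum_le_sum_of_subset (Finset.filter_subset _ _)) ?_
  refine le_trans (le_of_eq ?_) (levelPricing_le_seqRev D rule N (costPrice D rule N ρ))
  simp only [availLaw_costPrice]

/-- Every item is available with probability at least `1/2` if the costs cannot grow too much. -/
theorem unavail_costState_le {i : ℕ} (hi : i ≤ n) (j : Fin m)
    (h : m * ρ + N * seqRev D rule < ρ * 2 ^ ((N : ℝ) / 2)) :
    unavail (costState D rule N ρ i).1 j ≤ 1 / 2 := by
  by_contra! hcon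
  have hu : unavail (costState D rule N ρ i).1 j ≠ ∞ := by
    refine ne_top_of_le_ne_top ENNReal.one_ne_top ?_
    rw [← sum_costState D rule N ρ i]
    exact Finset.sum_le_sum_of_subset (Finset.filter_subset _ _)
  have h1 : (1 : ℝ) / 2 ≤ (unavail (costState D rule N ρ i).1 j).toReal := by
    have := ENNReal.toReal_mono hu hcon.le
    simpa using this
  refine absurd (h.trans_le ?_) (lt_irrefl _)
  calc ρ * 2 ^ ((N : ℝ) / 2)
      ≤ ρ * 2 ^ (N * (unavail (costState D rule N ρ i).1 j).toReal) := by
        gcongr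
        · norm_num
        · rw [div_eq_mul_one_div]
          gcongr
    _ ≤ (costState D rule N ρ i).2 j := mul_two_rpow_le_cost D rule N ρ i j
    _ ≤ ∑ j, (costState D rule N ρ i).2 j :=
        Finset.single_le_sum (f := (costState D rule N ρ i).2) (fun _ _ => zero_le)
          (Finset.mem_univ j)
    _ ≤ _ := sum_cost_le_seqRev D rule N ρ i hi

end CompoundingPrices

/-! ### Lotteries whose price is below the top level. -/

section LowPrice

variable {m : ℕ}

lemma sum_lottery (ℓ : Lottery m) : ∑ S, ℓ S = 1 := by
  rw [← tsum_fintype (L := .unconditional _)]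
  exact ℓ.tsum_coe

lemma sum_lottery_mul_sum (ℓ : Lottery m) (x : Fin m → ℝ≥0∞) :
    ∑ S, ℓ S * ∑ j ∈ S, x j = ∑ j, x j * itemProb ℓ j := by
  have : ∀ S, ℓ S * ∑ j ∈ S, x j = ∑ j, if j ∈ S then x j * ℓ S else 0 := by
    intro S
    rw [Finset.sum_ite_mem, Finset.univ_inter, Finset.mul_sum]
    exact Finset.sum_congr rfl fun _ _ => mul_comm _ _
  simp_rw [this]
  rw [Finset.sum_comm]
  refine Finset.sum_congr rfl fun j _ => ?_
  rw [itemProb, Finset.mul_sum, Finset.sum_filter]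

lemma ofReal_lotteryValue (v : Valuation m) (ℓ : Lottery m) :
    ENNReal.ofReal (lotteryValue v ℓ) = ∑ S, ℓ S * (v.1 S : ℝ≥0∞) := by
  rw [lotteryValue, ENNReal.ofReal_sum_of_nonneg fun _ _ => by positivity]
  refine Finset.sum_congr rfl fun S _ => ?_
  rw [ENNReal.ofReal_mul ENNReal.toReal_nonneg, ENNReal.ofReal_toReal (ℓ.apply_ne_top S),
    ENNReal.ofReal_coe_nnreal]

/-- Truncation at `τ` preserves subadditivity, so the covering bound applies. Truncated values are
what payments up to a level with prices at least `τ` can control. -/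
lemma min_value_le_sum_avail {v : Valuation m} (hv : IsSubadditive v) {a : Finset (Fin m) → ℝ≥0∞}
    (ha : ∑ A, a A = 1) (hu : ∀ j, unavail a j ≤ 1 / 2) {h : ℕ} (hh : (harmonic m : ℝ) ≤ h)
    (τ : ℝ≥0) (T : Finset (Fin m)) :
    min (v.1 T : ℝ≥0∞) τ ≤ 4 * h * ∑ A, a A * min (v.1 (T ∩ A) : ℝ≥0∞) τ := by
  have hfin : ∀ A, a A ≠ ∞ := fun A => ne_top_of_le_ne_top ENNReal.one_ne_top
    (ha ▸ Finset.single_le_sum (f := a) (fun _ _ => zero_le) (Finset.mem_univ A))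
  have h1 := subadditive_le_harmonic_mul_sum (g := fun S => ((min (v.1 S) τ : ℝ≥0) : ℝ))
    (by simp [v.2.1])
    (fun S S' hS => by
      have := v.2.2 hS
      exact_mod_cast min_le_min_right τ this)
    (fun S S' => by
      have : min (v.1 (S ∪ S')) τ ≤ min (v.1 S) τ + min (v.1 S') τ := by
        have := hv S S'
        rcases le_total (v.1 S) τ with h1 | h1 <;> rcases le_total (v.1 S') τ with h2 | h2
        · rw [min_eq_left h1, min_eq_left h2]
          exact (min_le_left _ _).trans this
        · rw [min_eq_right h2]
          exact (min_le_right _ _).trans le_add_self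
        all_goals
          rw [min_eq_right h1]
          exact (min_le_right _ _).trans le_self_add
      exact_mod_cast this)
    (a := fun A => (a A).toReal) (fun _ => ENNReal.toReal_nonneg)
    (by rw [← ENNReal.toReal_sum fun A _ => hfin A, ha, ENNReal.toReal_one])
    (fun j => by
      rw [← ENNReal.toReal_sum fun A _ => hfin A]
      have := ENNReal.toReal_mono (by norm_num) (hu j)
      simpa [unavail] using this) T
  have hnn : (0 : ℝ) ≤ ∑ A, (a A).toReal * ((min (v.1 (T ∩ A)) τ : ℝ≥0) : ℝ) := by positivity
  have h2 : ((min (v.1 T) τ : ℝ≥0) : ℝ)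
      ≤ 4 * h * ∑ A, (a A).toReal * ((min (v.1 (T ∩ A)) τ : ℝ≥0) : ℝ) :=
    h1.trans (by gcongr)
  have h3 := ENNReal.ofReal_le_ofReal h2
  rw [ENNReal.ofReal_coe_nnreal, ENNReal.ofReal_mul (by positivity),
    ENNReal.ofReal_mul (by positivity), ENNReal.ofReal_natCast,
    ENNReal.ofReal_sum_of_nonneg fun _ _ => by positivity] at h3
  rw [← ENNReal.coe_min]
  refine h3.trans (le_of_eq ?_)
  congr 1
  · simp
  refine Finset.sum_congr rfl fun A _ => ?_
  rw [ENNReal.ofReal_mul ENNReal.toReal_nonneg, ENNReal.ofReal_toReal (hfin A),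
    ENNReal.ofReal_coe_nnreal, ENNReal.coe_min]

/-- The price of a lottery is bounded by the payments for item prices at geometrically growing levels
and by the cost of the lottery at the lowest level, if the price is small compared to the highest
level and every item is available with probability at least `1/2`. -/
theorem price_le_sum_pay_add_cost (b : PurchaseRule m) {v : Valuation m} (hv : IsSubadditive v)
    {a : Finset (Fin m) → ℝ≥0∞} (ha : ∑ A, a A = 1) (hu : ∀ j, unavail a j ≤ 1 / 2) {h : ℕ}
    (hh : (harmonic m : ℝ) ≤ h) {r : ℕ → Fin m → ℝ≥0∞} (hr : ∀ k j, r (k + 1) j ≤ 2 * r k j)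
    (K : ℕ) {τ : ℝ≥0} (hτ : ∀ j, (τ : ℝ≥0∞) ≤ r K j) (ℓ : Lottery m) {p : ℝ≥0∞}
    (hp : p ≤ ∑ S, ℓ S * (v.1 S : ℝ≥0∞)) (hpτ : p + 4 * h * ∑ j, r 0 j ≤ τ) :
    p ≤ 4 * h * (∑ A, a A * ∑ k ∈ Finset.range (K + 1), pay b v A (r k)
      + ∑ j, r 0 j * itemProb ℓ j) := by
  set Y := ∑ A, a A * ∑ k ∈ Finset.range (K + 1), pay b v A (r k) with hY
  have key : ∀ T, min (v.1 T : ℝ≥0∞) τ ≤ 4 * h * (Y + ∑ j ∈ T, r 0 j) := by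
    intro T
    refine (min_value_le_sum_avail hv ha hu hh τ T).trans ?_
    gcongr
    calc ∑ A, a A * min (v.1 (T ∩ A) : ℝ≥0∞) τ
        ≤ ∑ A, a A * (∑ j ∈ T, r 0 j + ∑ k ∈ Finset.range (K + 1), pay b v A (r k)) := by
          gcongr with A
          refine (min_value_le_sum_payments (fun k => b.isBundlePurchase v A (r k)) hr K hτ
            Finset.inter_subset_right).trans ?_
          gcongr ?_ + ?_
          · exact Finset.sum_le_sum_of_subset Finset.inter_subset_left
          · exact le_rfl
      _ = Y + ∑ j ∈ T, r 0 j := by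
          simp_rw [mul_add, Finset.sum_add_distrib, ← Finset.sum_mul, ha, one_mul]
          rw [add_comm]
  -- If no value exceeds `τ`, truncation is void and `key` can be averaged over `ℓ`. Otherwise `key`
  -- bounds `τ` itself, and `hpτ` leaves room to cancel the lowest-level prices.
  rcases le_total (v.1 Finset.univ) τ with hle | hle
  · have key' : ∀ T, (v.1 T : ℝ≥0∞) ≤ 4 * h * (Y + ∑ j ∈ T, r 0 j) := by
      intro T
      have := key T
      rwa [min_eq_left] at this
      exact_mod_cast (v.2.2 (Finset.subset_univ T)).trans hle
    refine hp.trans ((Finset.sum_le_sum fun S _ => mul_le_mul_right (key' S) _).trans ?_)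
    rw [← sum_lottery_mul_sum]
    calc ∑ S, ℓ S * (4 * h * (Y + ∑ j ∈ S, r 0 j))
        = 4 * h * ∑ S, (ℓ S * Y + ℓ S * ∑ j ∈ S, r 0 j) := by
          rw [Finset.mul_sum]
          exact Finset.sum_congr rfl fun S _ => by ring
      _ ≤ _ := by
          rw [Finset.sum_add_distrib, ← Finset.sum_mul, sum_lottery, one_mul]
  · have h1 := key Finset.univ
    rw [min_eq_right (by exact_mod_cast hle), mul_add] at h1
    have hfin : 4 * (h : ℝ≥0∞) * ∑ j, r 0 j ≠ ∞ :=
      ne_top_of_le_ne_top ENNReal.coe_ne_top (le_add_self.trans hpτ)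
    have h2 := ENNReal.le_of_add_le_add_right hfin (hpτ.trans h1)
    exact h2.trans (by gcongr; exact le_self_add)

end LowPrice

/-! ### Buy-many menus against their unit prices. -/

section Hunting

variable {m : ℕ}

lemma sum_bind_map_mul (ℓ : Lottery m) (o : Finset (Fin m) → Lottery m)
    (φ : Finset (Fin m) → ℝ≥0∞) :
    ∑ T, (ℓ.bind fun S => (o S).map fun T => S ∪ T) T * φ T
      = ∑ S, ℓ S * ∑ T, o S T * φ (S ∪ T) := by
  simp_rw [PMF.bind_apply, PMF.map_apply, tsum_fintype, Finset.sum_mul, Finset.mul_sum]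
  rw [Finset.sum_comm]
  refine Finset.sum_congr rfl fun S _ => ?_
  simp_rw [Finset.sum_mul]
  rw [Finset.sum_comm]
  refine Finset.sum_congr rfl fun T _ => ?_
  simp [mul_assoc]

/-- The probability that a strategy does not obtain all items of `S`. -/
def Strategy.miss (s : Strategy m) (S : Finset (Fin m)) : ℝ≥0∞ :=
  ∑ T, s.outcome T * if S ⊆ T then 0 else 1

/-- Buy the lottery `ℓ` until item `j` is obtained, but at most `R` times, and go on with `s`. -/
def hunt (ℓ : Lottery m) (j : Fin m) : ℕ → Strategy m → Strategy m
  | 0, s => s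
  | R + 1, s => .buy ℓ fun S => if j ∈ S then s else hunt ℓ j R s

lemma itemProb_add (ℓ : Lottery m) (j : Fin m) :
    itemProb ℓ j + ∑ S with j ∉ S, ℓ S = 1 := by
  rw [← sum_lottery ℓ, itemProb, Finset.sum_filter_add_sum_filter_not]

lemma itemProb_le_one (ℓ : Lottery m) (j : Fin m) : itemProb ℓ j ≤ 1 :=
  itemProb_add ℓ j ▸ le_self_add

/-- One try costs at most `Q` times its success probability, and a failure leaves an expected cost
of at most `Q` for the rest of the hunt; the two add up to `Q` for every `R`. -/
lemma cost_hunt_le (p : PriceMenu m) {ℓ : Lottery m} {j : Fin m} {Q : ℝ≥0∞}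
    (hQ : p.price ℓ ≤ Q * itemProb ℓ j) (R : ℕ) (s : Strategy m) :
    (hunt ℓ j R s).cost p ≤ Q + s.cost p := by
  induction R with
  | zero => exact le_add_self
  | succ R ih =>
    rw [hunt, Strategy.cost]
    calc p.price ℓ + ∑ S, ℓ S * (if j ∈ S then s else hunt ℓ j R s).cost p
        ≤ Q * itemProb ℓ j + ∑ S, (ℓ S * s.cost p + Q * if j ∉ S then ℓ S else 0) := by
          gcongr with S
          by_cases hj : j ∈ S
          · simp [hj]
          · simp only [hj, if_false, not_false_eq_true, if_true]
            refine (mul_le_mul_right ih _).trans (le_of_eq (by ring))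
      _ = Q * (itemProb ℓ j + ∑ S with j ∉ S, ℓ S) + s.cost p := by
          rw [Finset.sum_add_distrib, ← Finset.sum_mul, sum_lottery, one_mul, ← Finset.mul_sum,
            ← Finset.sum_filter]
          ring
      _ = Q + s.cost p := by rw [itemProb_add, mul_one]

lemma Strategy.miss_mono (s : Strategy m) {S S' : Finset (Fin m)} (h : S ⊆ S') :
    s.miss S ≤ s.miss S' := by
  unfold Strategy.miss
  gcongr with T
  by_cases hT : S' ⊆ T
  · simp [hT, h.trans hT]
  · simp only [hT, if_false]
    split_ifs <;> simp

lemma Strategy.miss_le_one (s : Strategy m) (S : Finset (Fin m)) : s.miss S ≤ 1 := by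
  rw [← sum_lottery s.outcome]
  unfold Strategy.miss
  gcongr with T
  split_ifs <;> simp

/-- Union bound: either all `R` independent tries fail, or `s` misses something other than `j`. -/
lemma miss_hunt_le (ℓ : Lottery m) (j : Fin m) (R : ℕ) (s : Strategy m) (S : Finset (Fin m)) :
    (hunt ℓ j R s).miss S ≤ s.miss (S \ {j}) + (∑ T with j ∉ T, ℓ T) ^ R := by
  induction R with
  | zero => exact (s.miss_le_one S).trans (by simp)
  | succ R ih =>
    rw [hunt, Strategy.miss, Strategy.outcome, sum_bind_map_mul]
    have hle : ∀ T, ∑ T', (if j ∈ T then s else hunt ℓ j R s).outcome T' *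
        (if S ⊆ T ∪ T' then 0 else 1) ≤
        s.miss (S \ {j}) + (∑ T with j ∉ T, ℓ T) ^ R * if j ∉ T then 1 else 0 := by
      intro T
      have h1 : ∀ s' : Strategy m, ∑ T', s'.outcome T' * (if S ⊆ T ∪ T' then 0 else 1)
          = s'.miss (S \ T) := by
        intro s'
        unfold Strategy.miss
        simp only [sdiff_le_iff, Finset.sup_eq_union]
      rw [h1]
      by_cases hj : j ∈ T
      · simp only [hj, if_true, not_true_eq_false, if_false, mul_zero, add_zero]
        exact s.miss_mono (Finset.sdiff_subset_sdiff subset_rfl (by simpa using hj))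
      · simp only [hj, if_false, not_false_eq_true, if_true, mul_one]
        exact (Strategy.miss_mono _ Finset.sdiff_subset).trans ih
    refine (Finset.sum_le_sum fun T _ => mul_le_mul_right (hle T) _).trans (le_of_eq ?_)
    simp_rw [mul_add, Finset.sum_add_distrib, ← Finset.sum_mul, sum_lottery, one_mul,
      mul_left_comm (ℓ _), ← Finset.mul_sum, mul_ite, mul_one, mul_zero, ← Finset.sum_filter]
    rw [pow_succ]

/-- Hunt for all items of a list, one after another. -/
def collect (ℓ : Fin m → Lottery m) (R : ℕ) : List (Fin m) → Strategy m
  | [] => .done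
  | j :: l => hunt (ℓ j) j R (collect ℓ R l)

lemma cost_collect_le (p : PriceMenu m) {ℓ : Fin m → Lottery m} {Q : Fin m → ℝ≥0∞} (R : ℕ)
    (l : List (Fin m)) (hQ : ∀ j ∈ l, p.price (ℓ j) ≤ Q j * itemProb (ℓ j) j) :
    (collect ℓ R l).cost p ≤ (l.map Q).sum := by
  induction l with
  | nil => simp [collect, Strategy.cost]
  | cons j l ih =>
    rw [collect, List.map_cons, List.sum_cons]
    refine (cost_hunt_le p (hQ j (by simp)) R _).trans ?_
    gcongr
    exact ih fun i hi => hQ i (by simp [hi])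

lemma miss_collect_le (ℓ : Fin m → Lottery m) (R : ℕ) (l : List (Fin m)) {S : Finset (Fin m)}
    (hS : S ⊆ l.toFinset) : (collect ℓ R l).miss S ≤
      (l.map fun j => (∑ T with j ∉ T, ℓ j T) ^ R).sum := by
  induction l generalizing S with
  | nil =>
    have : S = ∅ := by simpa using hS
    simp [this, Strategy.miss]
  | cons j l ih =>
    rw [collect, List.map_cons, List.sum_cons, add_comm]
    refine (miss_hunt_le _ j R _ S).trans ?_
    gcongr
    refine ih fun i hi => ?_
    have h1 := hS (Finset.sdiff_subset hi)
    simp only [List.toFinset_cons, Finset.mem_insert] at h1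
    rcases h1 with rfl | h1
    · simp at hi
    · exact h1

lemma sum_mul_le_of_dominates {ℓ ℓ' : Lottery m} (h : Dominates ℓ ℓ') (v : Valuation m) :
    ∑ S, ℓ' S * (v.1 S : ℝ≥0∞) ≤ ∑ S, ℓ S * (v.1 S : ℝ≥0∞) := by
  obtain ⟨κ, h1, h2, h3⟩ := h
  have hmap : ∀ g : Finset (Fin m) × Finset (Fin m) → Finset (Fin m),
      ∑ S, κ.map g S * (v.1 S : ℝ≥0∞) = ∑ x, κ x * (v.1 (g x) : ℝ≥0∞) := by
    intro g
    simp_rw [PMF.map_apply, tsum_fintype, Finset.sum_mul]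
    rw [Finset.sum_comm]
    exact Finset.sum_congr rfl fun x _ => by simp
  rw [← h1, ← h2, hmap, hmap]
  refine Finset.sum_le_sum fun x _ => ?_
  by_cases hx : κ x = 0
  · simp [hx]
  · gcongr
    exact v.2.2 (h3 x ((PMF.mem_support_iff _ _).2 hx))

variable {p : PriceMenu m} {v : Valuation m} {ℓ : Lottery m}

lemma PriceMenu.IsPurchase.price_le (h : p.IsPurchase v ℓ) :
    p.price ℓ ≤ ∑ S, ℓ S * (v.1 S : ℝ≥0∞) := by
  have h0 := h.2.1 (PMF.pure ∅) (by simp [p.price_empty])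
  have h1 : lotteryValue v (PMF.pure ∅) = 0 := by
    refine Finset.sum_eq_zero fun S _ => ?_
    by_cases hS : S = ∅
    · simp [hS, v.2.1]
    · simp [PMF.pure_apply, hS]
  simp only [PriceMenu.utility, h1, p.price_empty, ENNReal.toReal_zero, sub_zero, sub_nonneg] at h0
  rw [← ofReal_lotteryValue, ← ENNReal.ofReal_toReal h.1]
  exact ENNReal.ofReal_le_ofReal h0

lemma PriceMenu.IsPurchase.value_le (h : p.IsPurchase v ℓ) (ℓ' : Lottery m) :
    ∑ S, ℓ' S * (v.1 S : ℝ≥0∞) ≤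
      p.price ℓ' + (∑ S, ℓ S * (v.1 S : ℝ≥0∞) - p.price ℓ) := by
  by_cases hfin : p.price ℓ' = ∞
  · simp [hfin]
  have h0 := h.2.1 ℓ' hfin
  simp only [PriceMenu.utility] at h0
  rw [← ofReal_lotteryValue, ← ofReal_lotteryValue, ← ENNReal.ofReal_toReal hfin,
    ← ENNReal.ofReal_toReal h.1, ← ENNReal.ofReal_sub _ ENNReal.toReal_nonneg]
  refine le_trans (ENNReal.ofReal_le_ofReal ?_) ENNReal.ofReal_add_le
  linarith

/-- The cheapest price per unit of probability at which a menu sells item `j`. -/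
def PriceMenu.unitPrice (p : PriceMenu m) (j : Fin m) : ℝ≥0∞ :=
  ⨅ (ℓ : Lottery m) (_ : itemProb ℓ j ≠ 0), p.price ℓ / itemProb ℓ j

lemma PriceMenu.unitPrice_mul_le (p : PriceMenu m) (ℓ : Lottery m) (j : Fin m) :
    p.unitPrice j * itemProb ℓ j ≤ p.price ℓ := by
  by_cases h : itemProb ℓ j = 0
  · simp [h]
  · have hfin : itemProb ℓ j ≠ ∞ := ne_top_of_le_ne_top ENNReal.one_ne_top (itemProb_le_one ℓ j)
    exact (ENNReal.le_div_iff_mul_le (Or.inl h) (Or.inl hfin)).1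
      (iInf₂_le (f := fun (ℓ : Lottery m) (_ : itemProb ℓ j ≠ 0) => p.price ℓ / itemProb ℓ j) ℓ h)

/-- Under a buy-many menu, a buyer is at least as well off as under the item prices given by the unit
prices of the menu. -/
theorem PriceMenu.IsPurchase.value_le_unitPrice (h : p.IsPurchase v ℓ) (hp : p ∈ buyManyMenus m)
    (S : Finset (Fin m)) : (v.1 S : ℝ≥0∞) ≤
      ∑ j ∈ S, p.unitPrice j + (∑ T, ℓ T * (v.1 T : ℝ≥0∞) - p.price ℓ) := by
  set U := ∑ T, ℓ T * (v.1 T : ℝ≥0∞) - p.price ℓ with hU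
  by_cases hfin : ∀ j ∈ S, p.unitPrice j ≠ ∞
  swap
  · push Not at hfin
    obtain ⟨j, hj, hj'⟩ := hfin
    have : ∑ j ∈ S, p.unitPrice j = ∞ := ENNReal.sum_eq_top.2 ⟨j, hj, hj'⟩
    simp [this]
  -- The infimum in the unit price need not be attained, hence `ε`. Strategies are finite, hence a
  -- cap `R` on the number of tries, which then tends to infinity.
  have main : ∀ ε : ℝ≥0, 0 < ε →
      (v.1 S : ℝ≥0∞) ≤ ∑ j ∈ S, (p.unitPrice j + ε) + U := by
    intro ε hε
    have hex : ∀ j, ∃ ℓ : Lottery m, j ∈ S → itemProb ℓ j ≠ 0 ∧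
        p.price ℓ ≤ (p.unitPrice j + ε) * itemProb ℓ j := by
      intro j
      by_cases hj : j ∈ S
      · have hlt : p.unitPrice j < p.unitPrice j + ε :=
          ENNReal.lt_add_right (hfin j hj) (by exact_mod_cast hε.ne')
        obtain ⟨ℓ, hℓ⟩ := iInf_lt_iff.1 hlt
        obtain ⟨h0, hℓ'⟩ := iInf_lt_iff.1 hℓ
        have hne : itemProb ℓ j ≠ ∞ :=
          ne_top_of_le_ne_top ENNReal.one_ne_top (itemProb_le_one ℓ j)
        exact ⟨ℓ, fun _ => ⟨h0, (ENNReal.div_le_iff h0 hne).1 hℓ'.le⟩⟩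
      · exact ⟨PMF.pure ∅, fun h => absurd h hj⟩
    choose L hL using hex
    have hR : ∀ R : ℕ, (v.1 S : ℝ≥0∞) ≤ ∑ j ∈ S, (p.unitPrice j + ε) + U
        + (∑ j ∈ S, (∑ T with j ∉ T, L j T) ^ R) * v.1 S := by
      intro R
      set s := collect L R S.toList with hs
      obtain ⟨ℓ', hdom, hcost⟩ := hp s
      have h1 : s.cost p ≤ ∑ j ∈ S, (p.unitPrice j + ε) := by
        refine (cost_collect_le p (Q := fun j => p.unitPrice j + ε) R _
          fun j hj => (hL j (by simpa using hj)).2).trans (le_of_eq ?_)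
        rw [Finset.sum_map_toList]
      have h2 : s.miss S ≤ ∑ j ∈ S, (∑ T with j ∉ T, L j T) ^ R := by
        refine (miss_collect_le L R _ (by simp)).trans (le_of_eq ?_)
        rw [Finset.sum_map_toList]
      have h3 : (v.1 S : ℝ≥0∞) ≤ ∑ T, s.outcome T * (v.1 T : ℝ≥0∞) + s.miss S * v.1 S := by
        unfold Strategy.miss
        rw [Finset.sum_mul, ← Finset.sum_add_distrib]
        calc (v.1 S : ℝ≥0∞) = ∑ T, s.outcome T * (v.1 S : ℝ≥0∞) := by
              rw [← Finset.sum_mul, sum_lottery, one_mul]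
          _ ≤ _ := by
              refine Finset.sum_le_sum fun T _ => ?_
              by_cases hT : S ⊆ T
              · have : (v.1 S : ℝ≥0∞) ≤ v.1 T := by exact_mod_cast v.2.2 hT
                simp only [hT, if_true, mul_zero, zero_mul, add_zero]
                gcongr
              · simp [hT]
      refine h3.trans ?_
      gcongr
      exact (sum_mul_le_of_dominates hdom v).trans ((h.value_le ℓ').trans
        (by gcongr; exact hcost.trans h1))
    have hlim : Filter.Tendsto (fun R : ℕ => ∑ j ∈ S, (p.unitPrice j + ε) + U
        + (∑ j ∈ S, (∑ T with j ∉ T, L j T) ^ R) * v.1 S) Filter.atTop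
        (nhds (∑ j ∈ S, (p.unitPrice j + ε) + U + (∑ j ∈ S, 0) * v.1 S)) := by
      refine Filter.Tendsto.const_add _ (ENNReal.Tendsto.mul_const ?_ (Or.inr ENNReal.coe_ne_top))
      refine tendsto_finsetSum _ fun j hj => ENNReal.tendsto_pow_atTop_nhds_zero_of_lt_one ?_
      have h1 := itemProb_add (L j) j
      refine lt_of_le_of_ne (h1 ▸ le_add_self) fun h2 => (hL j hj).1 ?_
      rw [h2] at h1
      have := ENNReal.add_right_inj (a := 1) (b := itemProb (L j) j) (c := 0) ENNReal.one_ne_top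
      rw [add_comm] at h1
      exact this.1 (by simpa using h1)
    have := ge_of_tendsto' hlim hR
    simpa using this
  refine ENNReal.le_of_forall_pos_le_add fun ε hε _ => ?_
  have hm : (0 : ℝ≥0) < m + 1 := by positivity
  refine (main (ε / (m + 1)) (by positivity)).trans ?_
  rw [Finset.sum_add_distrib, Finset.sum_const, nsmul_eq_mul, add_right_comm]
  gcongr
  have hc : (S.card : ℝ≥0) ≤ m + 1 := by
    have := S.card_le_univ
    simp only [Fintype.card_fin] at this
    exact_mod_cast this.trans (Nat.le_succ m)
  have : (S.card : ℝ≥0) * (ε / (m + 1)) ≤ ε := by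
    calc (S.card : ℝ≥0) * (ε / (m + 1)) ≤ (m + 1) * (ε / (m + 1)) := by gcongr
      _ = ε := mul_div_cancel₀ _ hm.ne'
  exact_mod_cast this

/-- If the price of the purchased lottery is large compared to the floor `f`, then it is bounded by
the payments for scaled unit prices with floor `f`. -/
theorem PriceMenu.IsPurchase.price_le_sum_pay (h : p.IsPurchase v ℓ) (hp : p ∈ buyManyMenus m)
    (b : PurchaseRule m) {f β : ℝ≥0∞} (K : ℕ) (hβ : 1 ≤ β * 2 ^ K) (hβm : 4 * m * β ≤ 1)
    (hf : 4 * (f * ∑ j, itemProb ℓ j) ≤ p.price ℓ) :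
    p.price ℓ ≤ 2 * ∑ k ∈ Finset.range K,
      pay b v Finset.univ fun j => f + β * 2 ^ k * p.unitPrice j := by
  set r : ℕ → Fin m → ℝ≥0∞ := fun k j => f + β * 2 ^ k * p.unitPrice j with hr
  set Y := ∑ k ∈ Finset.range K, pay b v Finset.univ (r k) with hY
  set V := ∑ T, ℓ T * (v.1 T : ℝ≥0∞) with hV
  have hVfin : V ≠ ∞ := ENNReal.sum_ne_top.2 fun T _ =>
    ENNReal.mul_ne_top (ℓ.apply_ne_top T) ENNReal.coe_ne_top
  have hdbl : ∀ k j, r (k + 1) j ≤ 2 * r k j := by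
    intro k j
    simp only [hr]
    calc f + β * 2 ^ (k + 1) * p.unitPrice j ≤ (f + f) + β * 2 ^ (k + 1) * p.unitPrice j := by
          gcongr; exact le_self_add
      _ = _ := by ring
  have hT : ∀ T, (v.1 T : ℝ≥0∞) ≤ ∑ j ∈ T, r 0 j + Y + (V - p.price ℓ) := by
    intro T
    refine (value_le_sum_payments (fun k => b.isBundlePurchase v Finset.univ (r k)) hdbl K
      (Finset.subset_univ T)).trans ?_
    gcongr ?_ + ?_ + ?_
    · exact le_rfl
    · exact le_rfl
    -- At level `K` the prices exceed the unit prices, so item pricing leaves the buyer no more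
    -- utility than the menu does.
    refine tsub_le_iff_left.2 ((h.value_le_unitPrice hp _).trans ?_)
    gcongr with j
    simp only [hr]
    refine le_trans ?_ le_add_self
    calc p.unitPrice j = 1 * p.unitPrice j := (one_mul _).symm
      _ ≤ _ := by gcongr
  -- A quarter of the price for the floor (`hf`), and a quarter for the scaled unit prices, since
  -- each item accounts for at most the price of `ℓ`.
  have hr0 : ∑ j, r 0 j * itemProb ℓ j ≤ p.price ℓ / 2 := by
    have h1 : ∑ j, r 0 j * itemProb ℓ j
        = f * ∑ j, itemProb ℓ j + β * ∑ j, p.unitPrice j * itemProb ℓ j := by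
      simp only [hr, pow_zero, one_mul, add_mul, Finset.sum_add_distrib, Finset.mul_sum, mul_assoc]
    have h2 : ∑ j, p.unitPrice j * itemProb ℓ j ≤ m * p.price ℓ := by
      refine (Finset.sum_le_sum fun j _ => p.unitPrice_mul_le ℓ j).trans ?_
      simp
    rw [h1, ENNReal.le_div_iff_mul_le (by simp) (by simp)]
    have h3 : 4 * (f * ∑ j, itemProb ℓ j + β * ∑ j, p.unitPrice j * itemProb ℓ j)
        ≤ 2 * p.price ℓ := by
      calc _ ≤ 4 * (f * ∑ j, itemProb ℓ j) + 4 * (β * (m * p.price ℓ)) := by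
            rw [mul_add]; gcongr
        _ = 4 * (f * ∑ j, itemProb ℓ j) + (4 * m * β) * p.price ℓ := by ring
        _ ≤ p.price ℓ + 1 * p.price ℓ := by gcongr
        _ = _ := by ring
    have h4 : (4 : ℝ≥0∞) = 2 * 2 := by norm_num
    rw [h4, mul_assoc, ENNReal.mul_le_mul_iff_right (by simp) (by simp)] at h3
    rwa [mul_comm]
  have hVle : V ≤ p.price ℓ / 2 + Y + (V - p.price ℓ) := by
    calc V ≤ ∑ T, ℓ T * (∑ j ∈ T, r 0 j + Y + (V - p.price ℓ)) := by
          rw [hV]; gcongr with T; exact hT T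
      _ = ∑ j, r 0 j * itemProb ℓ j + Y + (V - p.price ℓ) := by
          rw [← sum_lottery_mul_sum]
          simp_rw [mul_add, Finset.sum_add_distrib, ← Finset.sum_mul, sum_lottery, one_mul]
      _ ≤ _ := by gcongr
  have hsum : p.price ℓ + (V - p.price ℓ) ≤ p.price ℓ / 2 + Y + (V - p.price ℓ) := by
    rw [add_tsub_cancel_of_le h.price_le]
    exact hVle
  have h5 := ENNReal.le_of_add_le_add_right (ne_top_of_le_ne_top hVfin tsub_le_self) hsum
  have hhalf : p.price ℓ / 2 ≠ ∞ := (ENNReal.div_lt_top h.1 (by simp)).ne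
  have h6 : p.price ℓ / 2 + p.price ℓ / 2 ≤ p.price ℓ / 2 + Y := by rwa [ENNReal.add_halves]
  have h7 := ENNReal.le_of_add_le_add_left hhalf h6
  calc p.price ℓ = 2 * (p.price ℓ / 2) := by rw [two_mul, ENNReal.add_halves]
    _ ≤ 2 * Y := by gcongr

end Hunting

/-! ### A high floor keeps all items available. -/

section FloorPrices

variable {n m : ℕ} (D : Fin n → Measure (Valuation m)) (rule : Fin n → PurchaseRule m) (N : ℕ)
  (r : Fin n → ℕ → Fin m → ℝ≥0∞) [NeZero N]

lemma mul_sum_availLaw_ne_univ_le_sum [∀ i, IsProbabilityMeasure (D i)] {f : ℝ≥0∞}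
    (hr : ∀ i k j, f ≤ r i k j) (k : ℕ) (hk : k ≤ n) :
    f * ∑ A with A ≠ Finset.univ, availLaw D rule N r k A ≤
      ∑ i ∈ Finset.univ.filter (fun i : Fin n => (i : ℕ) < k), ∑ A, availLaw D rule N r i A *
        ((N : ℝ≥0∞)⁻¹ * ∑ l ∈ Finset.range N, ∫⁻ v, pay (rule i) v A (r i l) ∂(D i)) := by
  induction k with
  | zero =>
    have : ∑ A with A ≠ Finset.univ, availLaw D rule N r 0 A = 0 :=
      Finset.sum_eq_zero fun A hA => by
        simp only [Finset.mem_filter, Finset.mem_univ, true_and] at hA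
        simp [availLaw, hA]
    simp [this]
  | succ k ih =>
    have h : k < n := hk
    have hfil : Finset.univ.filter (fun i : Fin n => (i : ℕ) < k + 1)
        = insert ⟨k, h⟩ (Finset.univ.filter fun i : Fin n => (i : ℕ) < k) := by
      ext i
      simp only [Finset.mem_filter, Finset.mem_univ, true_and, Finset.mem_insert, Fin.ext_iff]
      omega
    rw [hfil, Finset.sum_insert (by simp)]
    refine le_trans ?_ ((add_le_add (ih h.le) le_rfl).trans (add_comm _ _).le)
    simp only [availLaw, dif_pos h]
    exact availStep_ne_univ_le _ _ N _ _ (hr ⟨k, h⟩)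

/-- If every price is at least `f` and `f` is large compared to the optimal revenue, then it is likely
that nothing is ever sold. -/
theorem sum_lintegral_pay_univ_le [∀ i, IsProbabilityMeasure (D i)] {f : ℝ≥0∞}
    (hr : ∀ i k j, f ≤ r i k j) (hf : 2 * seqRev D rule < f) :
    ∑ i, (N : ℝ≥0∞)⁻¹ * ∑ k ∈ Finset.range N, ∫⁻ v, pay (rule i) v Finset.univ (r i k) ∂(D i)
      ≤ 2 * seqRev D rule := by
  -- Markov: `f` times the probability of an earlier sale is at most the optimal revenue, which is
  -- below `f / 2`.
  have hav : ∀ i : Fin n, 1 / 2 ≤ availLaw D rule N r i Finset.univ := by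
    intro i
    have h1 := (mul_sum_availLaw_ne_univ_le_sum D rule N r hr i i.2.le).trans
      ((Finset.sum_le_sum_of_subset (Finset.filter_subset _ _)).trans
        (levelPricing_le_seqRev D rule N r))
    have h2 : ∑ A with A ≠ Finset.univ, availLaw D rule N r i A ≤ 1 / 2 := by
      by_contra! hcon
      refine absurd hf (not_lt.2 ?_)
      calc f = 2 * (f * (1 / 2)) := by
            rw [mul_left_comm, one_div, ENNReal.mul_inv_cancel (by simp) (by simp), mul_one]
        _ ≤ _ := by gcongr; exact le_trans (by gcongr) h1
    have h3 := sum_availLaw D rule N r i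
    rw [← Finset.sum_filter_add_sum_filter_not Finset.univ (fun A => A ≠ Finset.univ)] at h3
    simp only [not_not, Finset.filter_eq', Finset.mem_univ, if_true, Finset.sum_singleton] at h3
    have h4 : (1 / 2 : ℝ≥0∞) + 1 / 2 = 1 := by
      rw [one_div]; exact ENNReal.inv_two_add_inv_two
    refine ENNReal.le_of_add_le_add_left (a := 1 / 2) (by simp) ?_
    exact (h4.trans h3.symm).le.trans (add_le_add h2 le_rfl)
  have h1 := levelPricing_le_seqRev D rule N r
  calc _ = 2 * ∑ i, (1 / 2) * ((N : ℝ≥0∞)⁻¹ * ∑ k ∈ Finset.range N,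
        ∫⁻ v, pay (rule i) v Finset.univ (r i k) ∂(D i)) := by
        rw [← Finset.mul_sum Finset.univ _ (1 / 2 : ℝ≥0∞), ← mul_assoc, one_div,
          ENNReal.mul_inv_cancel (by simp) (by simp), one_mul]
    _ ≤ 2 * seqRev D rule := by
        gcongr
        refine le_trans (Finset.sum_le_sum fun i _ => ?_) h1
        refine le_trans (mul_le_mul' (hav i) le_rfl) ?_
        exact Finset.single_le_sum (f := fun A => availLaw D rule N r i A * ((N : ℝ≥0∞)⁻¹ *
          ∑ k ∈ Finset.range N, ∫⁻ v, pay (rule i) v A (r i k) ∂(D i)))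
          (fun _ _ => zero_le) (Finset.mem_univ _)

end FloorPrices

/-- The choices for different indices are independent, so values can be replaced by suprema one
index at a time. -/
lemma sum_iSup_le {ι κ : Type*} [Fintype ι] [DecidableEq ι] [Nonempty κ] {g : ι → κ → ℝ≥0∞}
    {B : ℝ≥0∞} (h : ∀ q : ι → κ, ∑ i, g i (q i) ≤ B) : ∑ i, ⨆ x, g i x ≤ B := by
  have key : ∀ s : Finset ι, ∀ q : ι → κ, ∑ i ∈ s, (⨆ x, g i x) + ∑ i ∈ sᶜ, g i (q i) ≤ B := by
    intro s
    induction s using Finset.induction with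
    | empty => intro q; simpa using h q
    | insert i s hi ih =>
      intro q
      rw [Finset.sum_insert hi, add_assoc, ENNReal.iSup_add]
      refine iSup_le fun x => le_trans (le_of_eq ?_) (ih (Function.update q i x))
      have hc : sᶜ = insert i (insert i s)ᶜ := by
        ext l
        simp only [Finset.mem_compl, Finset.mem_insert]
        by_cases hl : l = i
        · simp [hl, hi]
        · simp [hl]
      rw [hc, Finset.sum_insert (by simp), Function.update_self, add_left_comm]
      congr 2
      refine Finset.sum_congr rfl fun l hl => ?_
      rw [Function.update_of_ne]
      rintro rfl
      simp at hl
  obtain ⟨x⟩ := ‹Nonempty κ›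
  simpa using key Finset.univ (fun _ => x)

/-! ### The ex ante revenue from one buyer. -/

section SingleBuyer

variable {m : ℕ} {D : Measure (Valuation m)}

lemma measurable_alloc {𝒞 : Set (PriceMenu m)} (j : Fin m) :
    Measurable fun M : Mechanism D 𝒞 => M.alloc j := by
  have h : Measurable fun M : Mechanism D 𝒞 => (M.revenue, M.alloc) := comap_measurable _
  exact (measurable_pi_apply j).comp (measurable_snd.comp h)

/-- The best expected payment for scaled item prices with floor `f`, when all items are available. -/
def floorRev (b : PurchaseRule m) (D : Measure (Valuation m)) (N : ℕ) (f : ℝ≥0∞) : ℝ≥0∞ :=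
  ⨆ q : Fin m → ℝ≥0∞, (N : ℝ≥0∞)⁻¹ * ∑ k ∈ Finset.range N,
    ∫⁻ v, pay b v Finset.univ (fun j => f + (2 ^ N)⁻¹ * 2 ^ k * q j) ∂D

/-- The optimal ex ante revenue of buy-many menus from a single buyer, bounded in terms of item
pricing and of the cost of the supply. -/
theorem revEx_buyManyMenus_le (b : PurchaseRule m) (hD : ∀ᵐ v ∂D, IsSubadditive v)
    {a : Finset (Fin m) → ℝ≥0∞} (ha : ∑ A, a A = 1) (hu : ∀ j, unavail a j ≤ 1 / 2) {h : ℕ}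
    (hh : (harmonic m : ℝ) ≤ h) {r : ℕ → Fin m → ℝ≥0∞} (hr : ∀ k j, r (k + 1) j ≤ 2 * r k j)
    (K : ℕ) {τ : ℝ≥0} (hτ : ∀ j, (τ : ℝ≥0∞) ≤ r K j) {f : ℝ≥0∞}
    (hf : 4 * (f * m) + 4 * h * ∑ j, r 0 j ≤ τ) (hm : 4 * m ≤ 2 ^ (K + 1)) (x : Fin m → ℝ≥0) :
    revEx D (buyManyMenus m) x ≤
      4 * h * ((K + 1 : ℕ) * ∑ A, a A * (((K + 1 : ℕ) : ℝ≥0∞)⁻¹ *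
        ∑ k ∈ Finset.range (K + 1), ∫⁻ v, pay b v A (r k) ∂D) + ∑ j, r 0 j * x j)
      + 2 * ((K + 1 : ℕ) * floorRev b D (K + 1) f) := by
  set N := K + 1 with hN
  have hNN : (N : ℝ≥0∞) * (N : ℝ≥0∞)⁻¹ = 1 := ENNReal.mul_inv_cancel (by simp [hN]) (by simp)
  have hβ : ((2 : ℝ≥0∞) ^ N)⁻¹ * 2 ^ N = 1 := ENNReal.inv_mul_cancel (by simp) (by simp)
  have hβm : 4 * (m : ℝ≥0∞) * ((2 : ℝ≥0∞) ^ N)⁻¹ ≤ 1 := by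
    calc 4 * (m : ℝ≥0∞) * ((2 : ℝ≥0∞) ^ N)⁻¹ ≤ 2 ^ N * ((2 : ℝ≥0∞) ^ N)⁻¹ := by
          gcongr; exact_mod_cast hm
      _ = 1 := by rw [mul_comm, hβ]
  have hpoint : ∀ M : Mechanism D (buyManyMenus m), ∀ᵐ v ∂D, M.menu.price (M.choice v) ≤
      4 * h * (∑ A, a A * ∑ k ∈ Finset.range N, pay b v A (r k)
        + ∑ j, r 0 j * itemProb (M.choice v) j)
      + 2 * ∑ k ∈ Finset.range N,
        pay b v Finset.univ (fun j => f + (2 ^ N)⁻¹ * 2 ^ k * M.menu.unitPrice j) := by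
    intro M
    filter_upwards [M.isPurchase_choice, hD] with v hv hsub
    -- A high price is charged to scaled unit prices. A low one is at most `4 * (f * m)`, which `hf`
    -- places below the top level.
    rcases le_total (4 * (f * ∑ j, itemProb (M.choice v) j)) (M.menu.price (M.choice v))
      with hle | hle
    · exact (hv.price_le_sum_pay M.menu_mem b N hβ.ge hβm hle).trans le_add_self
    · refine (price_le_sum_pay_add_cost b hsub ha hu hh hr K hτ (M.choice v) hv.price_le
        (le_trans ?_ hf)).trans le_self_add
      gcongr
      refine hle.trans ?_
      gcongr
      refine (Finset.sum_le_sum fun j _ => itemProb_le_one (M.choice v) j).trans ?_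
      simp
  have hrev : ∀ M : Mechanism D (buyManyMenus m), M.revenue ≤
      4 * h * (N * ∑ A, a A * ((N : ℝ≥0∞)⁻¹ *
        ∑ k ∈ Finset.range N, ∫⁻ v, pay b v A (r k) ∂D) + ∑ j, r 0 j * M.alloc j)
      + 2 * (N * floorRev b D N f) := by
    intro M
    have hm1 : Measurable fun v => ∑ A, a A * ∑ k ∈ Finset.range N, pay b v A (r k) :=
      Finset.measurable_sum _ fun A _ =>
        (Finset.measurable_sum _ fun k _ => measurable_pay b A (r k)).const_mul _
    have hm2 : ∀ j, AEMeasurable (fun v => itemProb (M.choice v) j) D := fun j =>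
      Finset.aemeasurable_fun_sum _ fun S _ => M.aemeasurable_choice S
    have hm3 : Measurable fun v => ∑ k ∈ Finset.range N,
        pay b v Finset.univ (fun j => f + (2 ^ N)⁻¹ * 2 ^ k * M.menu.unitPrice j) :=
      Finset.measurable_sum _ fun k _ => measurable_pay b _ _
    refine (lintegral_mono_ae (hpoint M)).trans ?_
    rw [lintegral_add_right _ (hm3.const_mul _), lintegral_const_mul _ hm3,
      lintegral_const_mul' _ _ (by finiteness), lintegral_add_left hm1,
      lintegral_finsetSum' _ fun j _ => (hm2 j).const_mul _,
      lintegral_finsetSum _ fun k _ => measurable_pay b _ _,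
      lintegral_finsetSum _ fun A _ =>
        (Finset.measurable_sum _ fun k _ => measurable_pay b A (r k)).const_mul _]
    gcongr ?_ * (?_ + ?_) + ?_ * ?_
    · exact le_rfl
    · rw [Finset.mul_sum]
      refine Finset.sum_le_sum fun A _ => le_of_eq ?_
      rw [lintegral_const_mul _ (Finset.measurable_sum _ fun k _ => measurable_pay b A (r k)),
        lintegral_finsetSum _ fun k _ => measurable_pay b A (r k), mul_left_comm, ← mul_assoc (N : ℝ≥0∞),
        hNN, one_mul]
    · refine Finset.sum_le_sum fun j _ => le_of_eq ?_
      rw [lintegral_const_mul'' _ (hm2 j)]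
      rfl
    · exact le_rfl
    · rw [← one_mul (∑ k ∈ Finset.range N, _), ← hNN, mul_assoc]
      gcongr
      exact le_iSup (fun q : Fin m → ℝ≥0∞ => (N : ℝ≥0∞)⁻¹ * ∑ k ∈ Finset.range N,
        ∫⁻ v, pay b v Finset.univ (fun j => f + (2 ^ N)⁻¹ * 2 ^ k * q j) ∂D) M.menu.unitPrice
  -- The bound is affine in the allocation and otherwise independent of the mechanism, so it
  -- survives randomizing over mechanisms.
  refine iSup₂_le fun μ hμ => (lintegral_mono hrev).trans ?_
  have hm4 : Measurable fun M : Mechanism D (buyManyMenus m) => ∑ j, r 0 j * M.alloc j :=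
    Finset.measurable_sum _ fun j _ => (measurable_alloc j).const_mul _
  rw [lintegral_add_right _ measurable_const, lintegral_const_mul' _ _ (by finiteness),
    lintegral_add_left measurable_const,
    lintegral_finsetSum _ fun j _ => (measurable_alloc j).const_mul _]
  simp only [lintegral_const, measure_univ, mul_one]
  gcongr with j
  rw [lintegral_const_mul _ (measurable_alloc j)]
  gcongr
  exact hμ j

end SingleBuyer

/-! ### Summing over the buyers. -/

section ManyBuyers

variable {n m : ℕ} {D : Fin n → Measure (Valuation m)} [∀ i, IsProbabilityMeasure (D i)]

theorem eaRev_le_of_parameters (hD : ∀ i, ∀ᵐ v ∂(D i), IsSubadditive v)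
    (rule : Fin n → PurchaseRule m) {h K : ℕ} (hh : (harmonic m : ℝ) ≤ h)
    (hm : 4 * m ≤ 2 ^ (K + 1)) {ρ f : ℝ≥0} (hf : 2 * seqRev D rule < f)
    (hρ : m * ρ + (K + 1 : ℕ) * seqRev D rule < ρ * 2 ^ (((K + 1 : ℕ) : ℝ) / 2))
    (hτ : 4 * ((f : ℝ≥0∞) * m) + 4 * h * (2 * (m * ρ) + (K + 1 : ℕ) * seqRev D rule)
      ≤ ρ * 2 ^ K) :
    eaRev D (buyManyMenus m) ≤ 4 * h * (2 * (m * ρ) + 2 * ((K + 1 : ℕ) * seqRev D rule))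
      + 4 * ((K + 1 : ℕ) * seqRev D rule) := by
  set N := K + 1 with hN
  set R := seqRev D rule with hR
  refine iSup₂_le fun x hx => ?_
  have hr0 : ∀ (i : Fin n) j, costPrice D rule N ρ i 0 j = (costState D rule N ρ i).2 j + ρ := by
    intro i j
    simp [costPrice, levelPrice, levelCost]
  have hcost := fun (i : ℕ) hi => sum_cost_le_seqRev D rule N ρ i hi
  have hbuyer : ∀ i, revEx (D i) (buyManyMenus m) (x i) ≤
      4 * h * (N * ∑ A, (costState D rule N ρ i).1 A * ((N : ℝ≥0∞)⁻¹ *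
        ∑ k ∈ Finset.range N, ∫⁻ v, pay (rule i) v A (costPrice D rule N ρ i k) ∂(D i))
        + ∑ j, costPrice D rule N ρ i 0 j * x i j)
      + 2 * (N * floorRev (rule i) (D i) N f) := by
    intro i
    refine revEx_buyManyMenus_le (rule i) (hD i) (sum_costState D rule N ρ i)
      (fun j => unavail_costState_le D rule N ρ i.2.le j hρ) hh
      (levelPrice_succ_le _ _ _ _ (sum_costState D rule N ρ i)) K (τ := ρ * 2 ^ K)
      (fun j => ?_) ?_ hm (x i)
    · simp only [levelPrice, ENNReal.coe_mul, ENNReal.coe_pow, ENNReal.coe_ofNat]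
      exact le_add_self
    · simp only [ENNReal.coe_mul, ENNReal.coe_pow, ENNReal.coe_ofNat]
      refine le_trans ?_ hτ
      gcongr
      change ∑ j, costPrice D rule N ρ i 0 j ≤ _
      simp only [hr0, Finset.sum_add_distrib, Finset.sum_const, Finset.card_univ, Fintype.card_fin,
        nsmul_eq_mul]
      refine (add_le_add_left (hcost i i.2.le) _).trans (le_of_eq ?_)
      ring
  have hlevel : ∑ i : Fin n, ∑ A, (costState D rule N ρ i).1 A * ((N : ℝ≥0∞)⁻¹ *
      ∑ k ∈ Finset.range N, ∫⁻ v, pay (rule i) v A (costPrice D rule N ρ i k) ∂(D i)) ≤ R := by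
    have := levelPricing_le_seqRev D rule N (costPrice D rule N ρ)
    simpa only [availLaw_costPrice] using this
  -- Costs increase over time, so all buyers can be charged the final costs; each item then counts
  -- at most once because its total supply is at most 1.
  have hsupply : ∑ i, ∑ j, costPrice D rule N ρ i 0 j * x i j ≤ 2 * (m * ρ) + N * R := by
    calc ∑ i, ∑ j, costPrice D rule N ρ i 0 j * x i j
        ≤ ∑ i, ∑ j, ((costState D rule N ρ n).2 j + ρ) * x i j := by
          gcongr with i _ j
          rw [hr0]
          gcongr
          exact costState_mono D rule N ρ i.2.le j
      _ = ∑ j, ((costState D rule N ρ n).2 j + ρ) * ∑ i, (x i j : ℝ≥0∞) := by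
          rw [Finset.sum_comm]
          exact Finset.sum_congr rfl fun j _ => by rw [Finset.mul_sum]
      _ ≤ ∑ j, ((costState D rule N ρ n).2 j + ρ) * 1 := by
          gcongr with j
          exact_mod_cast hx j
      _ ≤ 2 * (m * ρ) + N * R := by
          simp only [mul_one, Finset.sum_add_distrib, Finset.sum_const, Finset.card_univ,
            Fintype.card_fin, nsmul_eq_mul]
          refine (add_le_add_left (hcost n le_rfl) _).trans (le_of_eq ?_)
          ring
  have hfloor : ∑ i, floorRev (rule i) (D i) N f ≤ 2 * R := by
    refine sum_iSup_le fun q => ?_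
    exact sum_lintegral_pay_univ_le D rule N
      (fun i k j => (f : ℝ≥0∞) + (2 ^ N)⁻¹ * 2 ^ k * q i j) (fun _ _ _ => le_self_add) hf
  refine (Finset.sum_le_sum fun i _ => hbuyer i).trans ?_
  simp_rw [Finset.sum_add_distrib, ← Finset.mul_sum, Finset.sum_add_distrib, ← Finset.mul_sum]
  calc _ ≤ 4 * h * (N * R + (2 * (m * ρ) + N * R)) + 2 * (N * (2 * R)) := by gcongr
    _ = _ := by ring

end ManyBuyers

/-! ### Choice of the parameters. -/

section Constants

/-- Rounding up adds at most 1, which is at most log₂ m as `m ≥ 2`; and 2 / log 2 < 3. -/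
lemma clog_le_three_mul_log {m : ℕ} (hm : 2 ≤ m) : (Nat.clog 2 m : ℝ) ≤ 3 * Real.log m := by
  have hm' : (2 : ℝ) ≤ m := by exact_mod_cast hm
  have h1 : (2 : ℕ) ^ (Nat.clog 2 m - 1) < m := Nat.pow_pred_clog_lt_self (by norm_num) (by omega)
  have hd : 1 ≤ Nat.clog 2 m := Nat.clog_pos (by norm_num) hm
  have h2 : ((Nat.clog 2 m : ℝ) - 1) * Real.log 2 ≤ Real.log m := by
    have h3 : ((2 : ℝ) ^ (Nat.clog 2 m - 1)) ≤ m := by exact_mod_cast h1.le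
    have h4 := Real.log_le_log (by positivity) h3
    rwa [Real.log_pow, Nat.cast_sub hd, Nat.cast_one] at h4
  have h5 : Real.log 2 ≤ Real.log m := Real.log_le_log (by norm_num) hm'
  have h6 := Real.log_two_gt_d9
  have h7 : (1 : ℝ) ≤ Nat.clog 2 m := by exact_mod_cast hd
  nlinarith

lemma harmonic_le_clog_add_one {m : ℕ} (hm : 2 ≤ m) :
    (harmonic m : ℝ) ≤ (Nat.clog 2 m + 1 : ℕ) := by
  have h1 := harmonic_le_one_add_log m
  have h2 : (m : ℝ) ≤ 2 ^ Nat.clog 2 m := by exact_mod_cast Nat.le_pow_clog (by norm_num) m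
  have h3 := Real.log_le_log (by positivity) h2
  rw [Real.log_pow] at h3
  have h4 := Real.log_two_lt_d9
  have h5 : (0 : ℝ) ≤ Nat.clog 2 m := by positivity
  push_cast
  nlinarith

end Constants

/-- The target `w` is kept positive and separate from `R`, which may be 0, because the floor and `ρ`
are taken proportional to `w`. -/
theorem eaRev_le_of_lt {n m : ℕ} (hm : 2 ≤ m) {D : Fin n → Measure (Valuation m)}
    [∀ i, IsProbabilityMeasure (D i)] (hD : ∀ i, ∀ᵐ v ∂(D i), IsSubadditive v)
    (rule : Fin n → PurchaseRule m) {R w : ℝ≥0} (hR : seqRev D rule = R) (hw : 0 < w)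
    (hRw : 560 * (Nat.clog 2 m : ℝ) ^ 2 * R ≤ w) : eaRev D (buyManyMenus m) ≤ w := by
  have hh := harmonic_le_clog_add_one hm
  have hmd : m ≤ 2 ^ Nat.clog 2 m := Nat.le_pow_clog (by norm_num) m
  have hd : 1 ≤ Nat.clog 2 m := Nat.clog_pos (by norm_num) hm
  set d := Nat.clog 2 m with hd_def
  have hmx : (m : ℝ) ≤ 2 ^ d := by exact_mod_cast hmd
  have hhx : ((d : ℝ) + 1) ≤ 2 ^ d := by exact_mod_cast Nat.lt_two_pow_self (n := d)
  have hm' : (2 : ℝ) ≤ m := by exact_mod_cast hm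
  have hd' : (1 : ℝ) ≤ d := by exact_mod_cast hd
  have hR0 : (0 : ℝ) ≤ R := R.2
  have hw' : (0 : ℝ) < w := hw
  -- With `h = d + 1`, the `ρ` term of the final bound is exactly `w / 2`; `hNR` makes the revenue
  -- terms at most the other half.
  set ρ : ℝ≥0 := w / (16 * (d + 1) * m) with hρ_def
  have hρw : 16 * ((d : ℝ) + 1) * m * ρ = w := by
    rw [hρ_def]
    push_cast
    field_simp
  have hρ0 : (0 : ℝ) ≤ ρ := ρ.2
  -- The constant 560 is the value of the product of the two factors at `d = 1`.
  have hNR : (16 * ((d : ℝ) + 1) + 8) * ((4 * d + 10) * R) ≤ w := by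
    refine le_trans ?_ hRw
    rw [← mul_assoc]
    refine mul_le_mul_of_nonneg_right ?_ hR0
    nlinarith
  have hdNR : 16 * ((4 * (d : ℝ) + 10) * R) ≤ w := by
    refine le_trans ?_ hNR
    have : 0 ≤ (4 * (d : ℝ) + 10) * R := by positivity
    nlinarith
  have hwρ : (w : ℝ) ≤ 16 * (2 ^ d * 2 ^ d) * ρ := by
    rw [← hρw]
    have : ((d : ℝ) + 1) * m ≤ 2 ^ d * 2 ^ d := by gcongr
    have := mul_le_mul_of_nonneg_right this hρ0
    nlinarith
  have hmρ : 16 * ((m : ℝ) * ρ) ≤ w := by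
    rw [← hρw]
    have : 0 ≤ (d : ℝ) * (m * ρ) := by positivity
    nlinarith
  -- There are `4 * d + 10` levels, an even number, so half of it is a natural exponent: 32 · 4^d
  -- beats `w / ρ ≤ 16 · 4^d`. The top level 512 · 16^d `ρ` dominates `w * m`.
  have hmain := eaRev_le_of_parameters hD rule (h := d + 1) (K := 4 * d + 9) (ρ := ρ) (f := w) hh
    (by
      calc 4 * m ≤ 2 ^ 2 * 2 ^ d := by gcongr; norm_num
        _ = 2 ^ (2 + d) := (pow_add _ _ _).symm
        _ ≤ _ := Nat.pow_le_pow_right (by norm_num) (by omega))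
    (by
      rw [hR]
      have : 2 * R < w := by
        rw [← NNReal.coe_lt_coe]
        push_cast
        have : (0 : ℝ) ≤ d * R := by positivity
        nlinarith
      exact_mod_cast this)
    (by
      rw [hR]
      have h1 : (((4 * d + 9 + 1 : ℕ) : ℝ) / 2) = ((2 * d + 5 : ℕ) : ℝ) := by
        push_cast; ring
      rw [h1, ENNReal.rpow_natCast]
      have : (m : ℝ≥0) * ρ + (4 * d + 9 + 1 : ℕ) * R < ρ * 2 ^ (2 * d + 5) := by
        rw [← NNReal.coe_lt_coe]
        push_cast
        have h2 : (2 : ℝ) ^ (2 * d + 5) = 32 * (2 ^ d * 2 ^ d) := by ring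
        rw [h2]
        nlinarith
      exact_mod_cast this)
    (by
      rw [hR]
      have : 4 * (w * (m : ℝ≥0)) + 4 * (d + 1 : ℕ) * (2 * (m * ρ) + (4 * d + 9 + 1 : ℕ) * R)
          ≤ ρ * 2 ^ (4 * d + 9) := by
        rw [← NNReal.coe_le_coe]
        push_cast
        have h2 : (2 : ℝ) ^ (4 * d + 9) = 512 * ((2 ^ d * 2 ^ d) * (2 ^ d * 2 ^ d)) := by ring
        rw [h2]
        have h3 : 4 * ((d : ℝ) + 1) * (2 * (m * ρ) + (4 * d + 9 + 1) * R) ≤ w := by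
          have : 0 ≤ (4 * (d : ℝ) + 10) * R := by positivity
          nlinarith
        have h4 : (1 : ℝ) ≤ 2 ^ d := one_le_pow₀ (by norm_num)
        have h5 : (w : ℝ) * m ≤ 16 * (2 ^ d * 2 ^ d) * ρ * (2 ^ d * 2 ^ d) := by
          have : (m : ℝ) ≤ 2 ^ d * 2 ^ d := by nlinarith
          gcongr
        have h6 : 0 ≤ (2 ^ d * 2 ^ d) * (2 ^ d * 2 ^ d) * (ρ : ℝ) := by positivity
        nlinarith
      exact_mod_cast this)
  refine hmain.trans ?_
  rw [hR]
  have : 4 * (d + 1 : ℕ) * (2 * ((m : ℝ≥0) * ρ) + 2 * ((4 * d + 9 + 1 : ℕ) * R))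
      + 4 * ((4 * d + 9 + 1 : ℕ) * R) ≤ w := by
    rw [← NNReal.coe_le_coe]
    push_cast
    nlinarith
  exact_mod_cast this

end BuyMany

end

theorem mainTheorem2 :
    ∃ C : ℝ≥0, ∀ (n m : ℕ), 2 ≤ m →
      ∀ D : Fin n → Measure (BuyMany.Valuation m),
        (∀ i, IsProbabilityMeasure (D i)) →
        (∀ i, ∀ᵐ v ∂(D i), BuyMany.IsSubadditive v) →
        ∀ rule : Fin n → BuyMany.PurchaseRule m,
          BuyMany.eaRev D (BuyMany.buyManyMenus m) ≤
            C * ENNReal.ofReal (Real.log m ^ 2) * BuyMany.seqRev D rule := by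
  -- 5040 = 560 · 3², the square coming from `clog_le_three_mul_log`.
  refine ⟨5040, fun n m hm D _ hD rule => ?_⟩
  have hlog : 0 < Real.log m := Real.log_pos (by exact_mod_cast hm)
  by_cases hR : BuyMany.seqRev D rule = ∞
  · rw [hR, ENNReal.mul_top]
    · exact le_top
    · simpa using hlog.ne'
  obtain ⟨R, hR⟩ : ∃ R : ℝ≥0, (R : ℝ≥0∞) = BuyMany.seqRev D rule :=
    ⟨_, ENNReal.coe_toNNReal hR⟩
  rw [← hR]
  -- Passing to any `w` strictly above the bound gives a positive `w` even when the revenue is 0.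
  refine le_of_forall_gt_imp_ge_of_dense fun w hw => ?_
  rcases eq_or_ne w ∞ with rfl | hwtop
  · exact le_top
  lift w to ℝ≥0 using hwtop
  have hw' : 5040 * (Real.log m).toNNReal ^ 2 * R < w := by
    rw [ENNReal.ofReal_pow hlog.le, ENNReal.ofReal] at hw
    exact_mod_cast hw
  refine BuyMany.eaRev_le_of_lt hm hD rule hR.symm (pos_of_gt hw') ?_
  have h1 : 5040 * Real.log m ^ 2 * R < w := by
    rw [← NNReal.coe_lt_coe] at hw'
    push_cast at hw'
    rwa [Real.coe_toNNReal _ hlog.le] at hw'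
  refine le_trans ?_ h1.le
  have h2 := BuyMany.clog_le_three_mul_log hm
  calc 560 * (Nat.clog 2 m : ℝ) ^ 2 * R ≤ 560 * (3 * Real.log m) ^ 2 * R := by gcongr
    _ = _ := by ring
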